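/- For real $a,b$ let $M(a,b)$ (a Bianchi–Cartan–Vranceanu space) be the open set $\{(x,y,z)\in\mathbb R^3:\lambda_a=1+a(x^2+y^2)>0\}$ with the Riemannian metric $$g_{a,b}=\frac{dx^2+dy^2}{\lambda_a^2}+\Big(dz+\frac b2\,\frac{y\,dx-x\,dy}{\lambda_a}\Big)^2,$$ and put $E_3=\partial/\partial z$. A smooth curve $\gamma:I\to M$ from an open interval into a Riemannian manifold, parametrized by arc length with unit tangent $T=\gamma'$, is called triharmonic if $$\nabla_T^5T+R(\nabla_T^3T,T)T-R(\nabla_T^2T,\nabla_TT)T=0,$$ where $R(X,Y)Z=\nabla_X\nabla_YZ-\nabla_Y\nabla_XZ-\nabla_{[X,Y]}Z$, and a triharmonic curve is proper if it is not a geodesic. Its curvature is $\kappa=\|\nabla_TT\|$. In dimension 3, where $\kappa\ne0$, put $N=\kappa^{-1}\nabla_TT$, $B=T\times N$, and define the torsion by $\tau=\langle\nabla_TN,B\rangle$; the torsion is said to vanish if $\tau(s)=0$ at every $s$ with $\kappa(s)\neq0$. A Frenet helix is a curve with constant curvature and constant torsion. **Theorem.** Let $4a\neq b^2$ and let $\gamma:I\to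 M(a,b)$ be an arc-length parametrized triharmonic curve with vanishing torsion. Then the curvature of $\gamma$ is constant. Moreover, either $\gamma$ is a geodesic, or $\gamma$ is a Frenet helix with constant curvature $\kappa_0>0$ and zero torsion, the function $B_3=\langle B,E_3\rangle$ is constant along $\gamma$, $$\kappa_0^2=2\Big(\frac{b^2}{4}+(4a-b^2)B_3^2\Big),$$ and $B_3^2<\dfrac{b^2}{4(b^2-4a)}$ if $b^2>4a$, while $B_3\neq0$ if $b^2<4a$. In particular, for every $\rho<0$ there is no proper triharmonic curve with vanishing torsion in the product $\mathbb H^2(\rho)\times\mathbb R$ of the hyperbolic plane of curvature $\rho$ and the line. -/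

import Mathlib

open scoped ContDiff Matrix

namespace BCV

/-- Points of `ℝ³`, and also tangent vectors, written in the coordinate basis `∂/∂x, ∂/∂y, ∂/∂z`. -/
abbrev Vec : Type := Fin 3 → ℝ

/-- A metric tensor in the global coordinates `(x, y, z)`: the matrix `g_{ij}(p)`. -/
abbrev MetricTensor : Type := Vec → Matrix (Fin 3) (Fin 3) ℝ

/-! ### Riemannian geometry in a global chart -/

/-- The inner product `⟨u, v⟩` of two tangent vectors at `p`. -/
def ip (g : MetricTensor) (p u v : Vec) : ℝ := ∑ i, ∑ j, g p i j * u i * v j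

/-- The partial derivative `∂f/∂xⁱ` at `p`. -/
noncomputable def partialDeriv (i : Fin 3) (f : Vec → ℝ) (p : Vec) : ℝ :=
  fderiv ℝ f p (Pi.single i 1)

/-- The Christoffel symbols `Γᵏᵢⱼ` of the Levi-Civita connection of `g`. -/
noncomputable def christoffel (g : MetricTensor) (k i j : Fin 3) (p : Vec) : ℝ :=
  (1 / 2 : ℝ) * ∑ l, (g p)⁻¹ k l *
    (partialDeriv i (fun q => g q j l) p + partialDeriv j (fun q => g q i l) p
      - partialDeriv l (fun q => g q i j) p)

/-- The components of the curvature tensor,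
`R(∂ᵢ, ∂ⱼ)∂ₖ = ∇ᵢ∇ⱼ∂ₖ - ∇ⱼ∇ᵢ∂ₖ = ∑ₗ (curvatureCoeff g l k i j) ∂ₗ`. -/
noncomputable def curvatureCoeff (g : MetricTensor) (l k i j : Fin 3) (p : Vec) : ℝ :=
  partialDeriv i (christoffel g l j k) p - partialDeriv j (christoffel g l i k) p
    + ∑ m, (christoffel g l i m p * christoffel g m j k p
      - christoffel g l j m p * christoffel g m i k p)

/-- The Riemann curvature tensor `R(X, Y)Z` at `p`, with the convention
`R(X, Y)Z = ∇_X∇_Y Z - ∇_Y∇_X Z - ∇_{[X,Y]} Z`. -/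
noncomputable def riemann (g : MetricTensor) (p X Y Z : Vec) : Vec :=
  fun l => ∑ i, ∑ j, ∑ k, curvatureCoeff g l k i j p * X i * Y j * Z k

/-- The cross product of tangent vectors at `p` for the metric `g` and the orientation
`dx ∧ dy ∧ dz`: the vector `w` with `⟨w, x⟩ = √(det g) · det(u, v, x)` for all `x`. -/
noncomputable def cross (g : MetricTensor) (p u v : Vec) : Vec :=
  Real.sqrt (g p).det • ((g p)⁻¹ *ᵥ (u ⨯₃ v))

/-! ### Curves -/

/-- The covariant derivative `∇_T V` of a vector field `V` along the curve `γ`, `T = γ'`. -/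
noncomputable def covDeriv (g : MetricTensor) (γ : ℝ → Vec) (V : ℝ → Vec) : ℝ → Vec :=
  fun s k => deriv V s k + ∑ i, ∑ j, christoffel g k i j (γ s) * deriv γ s i * V s j

/-- The iterated covariant derivative `∇_T^m T` of the velocity `T = γ'`. -/
noncomputable def covT (g : MetricTensor) (γ : ℝ → Vec) (m : ℕ) : ℝ → Vec :=
  (covDeriv g γ)^[m] (deriv γ)

/-- The curve `γ`, defined on `I`, is a smooth curve in the region `M`, parametrized by
arc length for the metric `g`. -/
structure IsArcLengthCurve (g : MetricTensor) (M : Set Vec) (I : Set ℝ) (γ : ℝ → Vec) :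
    Prop where
  smooth : ContDiffOn ℝ ∞ γ I
  mapsTo : Set.MapsTo γ I M
  unit_speed : ∀ s ∈ I, ip g (γ s) (deriv γ s) (deriv γ s) = 1

/-- `τ₃(γ) = ∇_T⁵T + R(∇_T³T, T)T - R(∇_T²T, ∇_T T)T`. -/
noncomputable def tension₃ (g : MetricTensor) (γ : ℝ → Vec) (s : ℝ) : Vec :=
  covT g γ 5 s + riemann g (γ s) (covT g γ 3 s) (covT g γ 0 s) (covT g γ 0 s)
    - riemann g (γ s) (covT g γ 2 s) (covT g γ 1 s) (covT g γ 0 s)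

/-- Triharmonic curves: arc-length parametrized curves with `τ₃(γ) = 0`. -/
def IsTriharmonic (g : MetricTensor) (M : Set Vec) (I : Set ℝ) (γ : ℝ → Vec) : Prop :=
  IsArcLengthCurve g M I γ ∧ ∀ s ∈ I, tension₃ g γ s = 0

/-- Geodesics (harmonic curves): `∇_T T = 0`. -/
def IsGeodesic (g : MetricTensor) (I : Set ℝ) (γ : ℝ → Vec) : Prop :=
  ∀ s ∈ I, covT g γ 1 s = 0

/-- The curvature `κ = ‖∇_T T‖`. -/
noncomputable def curvature (g : MetricTensor) (γ : ℝ → Vec) (s : ℝ) : ℝ :=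
  Real.sqrt (ip g (γ s) (covT g γ 1 s) (covT g γ 1 s))

/-- The unit normal `N = κ⁻¹ ∇_T T` (meaningful where `κ ≠ 0`). -/
noncomputable def normal (g : MetricTensor) (γ : ℝ → Vec) (s : ℝ) : Vec :=
  (curvature g γ s)⁻¹ • covT g γ 1 s

/-- The binormal `B = T × N` (meaningful where `κ ≠ 0`). -/
noncomputable def binormal (g : MetricTensor) (γ : ℝ → Vec) (s : ℝ) : Vec :=
  cross g (γ s) (deriv γ s) (normal g γ s)

/-- The torsion `τ = ⟨∇_T N, B⟩` (meaningful where `κ ≠ 0`). -/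
noncomputable def torsion (g : MetricTensor) (γ : ℝ → Vec) (s : ℝ) : ℝ :=
  ip g (γ s) (covDeriv g γ (normal g γ) s) (binormal g γ s)

/-- The torsion vanishes wherever it is defined, that is at all points with `κ ≠ 0`. -/
def HasVanishingTorsion (g : MetricTensor) (I : Set ℝ) (γ : ℝ → Vec) : Prop :=
  ∀ s ∈ I, curvature g γ s ≠ 0 → torsion g γ s = 0

/-- A (non-geodesic) Frenet helix with constant curvature `κ₀ > 0` and constant torsion `τ₀`. -/
def IsFrenetHelix (g : MetricTensor) (I : Set ℝ) (γ : ℝ → Vec) (κ₀ τ₀ : ℝ) : Prop :=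
  0 < κ₀ ∧ ∀ s ∈ I, curvature g γ s = κ₀ ∧ torsion g γ s = τ₀

/-! ### The Bianchi-Cartan-Vranceanu spaces `M(a, b)` -/

/-- `λ_a = 1 + a (x² + y²)`. -/
def lam (a : ℝ) (p : Vec) : ℝ := 1 + a * (p 0 ^ 2 + p 1 ^ 2)

/-- The region `λ_a > 0` of `ℝ³`. -/
def domain (a : ℝ) : Set Vec := {p | 0 < lam a p}

/-- The coefficients of the one-form `dz + (b/2) (y dx - x dy) / λ_a`. -/
noncomputable def form (a b : ℝ) (p : Vec) : Vec :=
  ![b / 2 * (p 1 / lam a p), -(b / 2 * (p 0 / lam a p)), 1]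

/-- The metric `(dx² + dy²) / λ_a² + (dz + (b/2) (y dx - x dy) / λ_a)²`. -/
noncomputable def metric (a b : ℝ) : MetricTensor := fun p =>
  Matrix.diagonal ![1 / lam a p ^ 2, 1 / lam a p ^ 2, 0]
    + Matrix.vecMulVec (form a b p) (form a b p)

/-- The vector field `E₃ = ∂/∂z`. -/
def E₃ : Vec := ![0, 0, 1]

/-! ### The product space `ℍ²(ρ) × ℝ`, `ρ < 0` -/

/-- The Poincaré disc `x² + y² < -4/ρ` (for `ρ < 0`), times `ℝ`. -/
def hypProdDomain (ρ : ℝ) : Set Vec := {p | p 0 ^ 2 + p 1 ^ 2 < -(4 / ρ)}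

/-- The product of the Poincaré metric `(dx² + dy²) / (1 + (ρ/4)(x² + y²))²`, of constant Gaussian
curvature `ρ`, and of the line `dz²`. -/
noncomputable def hypProdMetric (ρ : ℝ) : MetricTensor := fun p =>
  Matrix.diagonal ![1 / (1 + ρ / 4 * (p 0 ^ 2 + p 1 ^ 2)) ^ 2,
    1 / (1 + ρ / 4 * (p 0 ^ 2 + p 1 ^ 2)) ^ 2, 1]

end BCV

/-! In the orthonormal frame dual to `dx/λ`, `dy/λ`, `dz + (b/2)(y dx - x dy)/λ`, the Levi-Civita
connection along a curve is `v' + Ω × v`, and the curvature tensor has constant coefficients apart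
from terms in the third components (`hasCov_fr`, `fr_riemann`).

Without torsion, `B` is parallel and every `∇_T^m T` stays in the plane of `T` and `N`, so the
curvature terms of the triharmonic equation collapse to `(k'' - 2k³) R(N,T)T`. Its binormal
component is `(k'' - 2k³)(b² - 4a) N₃ B₃ = 0`. On an open set where `k'' = 2k³`, the tangential
component forces `k' = 0`, hence `k = 0`; so away from inflection points `N₃ B₃ = 0`
(`eq_zero_of_binormal_equation`). As `B₃' = (b/2) N₃`, the square `B₃²` is constant, and so is the
sectional curvature `K = b²/4 + (4a - b²) B₃²` of the osculating plane.

The tangential equation now has two first integrals. Eliminating derivatives from the normal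
equation leaves a nonzero polynomial satisfied by `k`, so `k` is constant (`curvature_constant`),
and the normal equation reads `k² = 2K`. Connectedness then excludes inflection points on a
non-geodesic. The bounds on `B₃` come from `k² > 0` and, when `b² < 4a`, from the impossibility of
`T₃ = N₃ = B₃ = 0`. -/

namespace BCV

/-! ### Coordinates and the orthonormal frame -/

/-- `1 / λ_a`. -/
noncomputable def cm (a : ℝ) (p : Vec) : ℝ := (lam a p)⁻¹

/-- `x / λ_a`. -/
noncomputable def cu (a : ℝ) (p : Vec) : ℝ := p 0 / lam a p

/-- `y / λ_a`. -/
noncomputable def cv (a : ℝ) (p : Vec) : ℝ := p 1 / lam a p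

theorem cm_pos {a : ℝ} {p : Vec} (hp : p ∈ domain a) : 0 < cm a p := inv_pos.mpr hp

/-- The definition of `λ` divided by `λ²`. This is the only relation among `1/λ`, `x/λ`, `y/λ`; it
lets `1/λ²` be replaced by an expression linear in `1/λ`, so that later identities are polynomial.
-/
theorem cm_sq {a : ℝ} {p : Vec} (hp : p ∈ domain a) :
    cm a p ^ 2 = cm a p - a * (cu a p ^ 2 + cv a p ^ 2) := by
  have h : lam a p ≠ 0 := ne_of_gt hp
  simp only [cm, cu, cv]
  field_simp
  simp only [lam]
  ring

theorem isOpen_domain (a : ℝ) : IsOpen (domain a) := by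
  have : Continuous (lam a) := by unfold lam; fun_prop
  exact isOpen_lt continuous_const this

theorem hasFDerivAt_coord (i : Fin 3) (p : Vec) :
    HasFDerivAt (fun q : Vec => q i) (ContinuousLinearMap.proj (R := ℝ) (φ := fun _ : Fin 3 => ℝ) i) p :=
  hasFDerivAt_apply i p

theorem hasFDerivAt_lam (a : ℝ) (p : Vec) :
    HasFDerivAt (lam a) ((2 * a * p 0) • ContinuousLinearMap.proj (R := ℝ) (φ := fun _ : Fin 3 => ℝ) 0
      + (2 * a * p 1) • ContinuousLinearMap.proj (R := ℝ) (φ := fun _ : Fin 3 => ℝ) 1) p := by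
  have h := ((((hasFDerivAt_coord 0 p).pow 2).add ((hasFDerivAt_coord 1 p).pow 2)).const_mul a).const_add 1
  refine HasFDerivAt.congr_fderiv h ?_
  ext w
  simp
  ring

theorem hasFDerivAt_cm {a : ℝ} {p : Vec} (hp : p ∈ domain a) :
    HasFDerivAt (cm a) ((-2 * a * cu a p * cm a p) • ContinuousLinearMap.proj (R := ℝ) (φ := fun _ : Fin 3 => ℝ) 0
      + (-2 * a * cv a p * cm a p) • ContinuousLinearMap.proj (R := ℝ) (φ := fun _ : Fin 3 => ℝ) 1) p := by
  have h0 : lam a p ≠ 0 := ne_of_gt hp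
  have h := (hasDerivAt_inv h0).comp_hasFDerivAt p (hasFDerivAt_lam a p)
  refine HasFDerivAt.congr_fderiv h ?_
  ext w
  simp [cm, cu, cv]
  field_simp

theorem hasFDerivAt_cu {a : ℝ} {p : Vec} (hp : p ∈ domain a) :
    HasFDerivAt (cu a) ((cm a p - 2 * a * cu a p ^ 2) • ContinuousLinearMap.proj (R := ℝ) (φ := fun _ : Fin 3 => ℝ) 0
      + (-2 * a * cu a p * cv a p) • ContinuousLinearMap.proj (R := ℝ) (φ := fun _ : Fin 3 => ℝ) 1) p := by
  have h0 : lam a p ≠ 0 := ne_of_gt hp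
  have h := (hasFDerivAt_coord 0 p).mul (hasFDerivAt_cm hp)
  refine HasFDerivAt.congr_fderiv (f := cu a) (h.congr_of_eventuallyEq ?_) ?_
  · exact Filter.Eventually.of_forall fun q => by simp [cm, cu, div_eq_mul_inv]
  · ext w
    simp [cm, cu, cv]
    field_simp
    ring

theorem hasFDerivAt_cv {a : ℝ} {p : Vec} (hp : p ∈ domain a) :
    HasFDerivAt (cv a) ((-2 * a * cu a p * cv a p) • ContinuousLinearMap.proj (R := ℝ) (φ := fun _ : Fin 3 => ℝ) 0
      + (cm a p - 2 * a * cv a p ^ 2) • ContinuousLinearMap.proj (R := ℝ) (φ := fun _ : Fin 3 => ℝ) 1) p := by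
  have h0 : lam a p ≠ 0 := ne_of_gt hp
  have h := (hasFDerivAt_coord 1 p).mul (hasFDerivAt_cm hp)
  refine HasFDerivAt.congr_fderiv (f := cv a) (h.congr_of_eventuallyEq ?_) ?_
  · exact Filter.Eventually.of_forall fun q => by simp [cm, cv, div_eq_mul_inv]
  · ext w
    simp [cm, cu, cv]
    field_simp
    ring

/-- The gradient of a function of the form `P (1/λ) (x/λ) (y/λ)`, coordinatewise. -/
structure HasGrad (f : Vec → ℝ) (d : Vec) (p : Vec) : Prop where
  differentiableAt : DifferentiableAt ℝ f p
  partialDeriv_eq : ∀ i, partialDeriv i f p = d i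

theorem HasGrad.const (c : ℝ) (p : Vec) : HasGrad (fun _ => c) 0 p :=
  ⟨differentiableAt_const c, fun i => by simp [partialDeriv]⟩

theorem HasGrad.add {f h : Vec → ℝ} {d e p : Vec} (hf : HasGrad f d p) (hh : HasGrad h e p) :
    HasGrad (fun q => f q + h q) (d + e) p :=
  ⟨hf.1.add hh.1, fun i => by
    simp [partialDeriv, fderiv_fun_add hf.1 hh.1, ← hf.2, ← hh.2]⟩

theorem HasGrad.mul {f h : Vec → ℝ} {d e p : Vec} (hf : HasGrad f d p) (hh : HasGrad h e p) :
    HasGrad (fun q => f q * h q) (h p • d + f p • e) p :=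
  ⟨hf.1.mul hh.1, fun i => by
    simp [partialDeriv, fderiv_fun_mul hf.1 hh.1, ← hf.2, ← hh.2]; ring⟩

theorem HasGrad.congr {f h : Vec → ℝ} {d p : Vec} (hf : HasGrad f d p)
    (hh : h =ᶠ[nhds p] f) : HasGrad h d p :=
  ⟨hf.1.congr_of_eventuallyEq hh, fun i => by
    rw [← hf.2, partialDeriv, partialDeriv, hh.fderiv_eq]⟩

theorem hasGrad_cm {a : ℝ} {p : Vec} (hp : p ∈ domain a) :
    HasGrad (cm a) ![-2 * a * cu a p * cm a p, -2 * a * cv a p * cm a p, 0] p :=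
  ⟨(hasFDerivAt_cm hp).differentiableAt, fun i => by
    rw [partialDeriv, (hasFDerivAt_cm hp).fderiv]; fin_cases i <;> simp⟩

theorem hasGrad_cu {a : ℝ} {p : Vec} (hp : p ∈ domain a) :
    HasGrad (cu a) ![cm a p - 2 * a * cu a p ^ 2, -2 * a * cu a p * cv a p, 0] p :=
  ⟨(hasFDerivAt_cu hp).differentiableAt, fun i => by
    rw [partialDeriv, (hasFDerivAt_cu hp).fderiv]; fin_cases i <;> simp⟩

theorem hasGrad_cv {a : ℝ} {p : Vec} (hp : p ∈ domain a) :
    HasGrad (cv a) ![-2 * a * cu a p * cv a p, cm a p - 2 * a * cv a p ^ 2, 0] p :=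
  ⟨(hasFDerivAt_cv hp).differentiableAt, fun i => by
    rw [partialDeriv, (hasFDerivAt_cv hp).fderiv]; fin_cases i <;> simp⟩

/-- An affine function of `1/λ` plus a quadratic polynomial in `x/λ` and `y/λ`, with the
coefficients `c`. -/
noncomputable def poly (a : ℝ) (c : Fin 7 → ℝ) (q : Vec) : ℝ :=
  c 0 + c 1 * cm a q + c 2 * cu a q + c 3 * cv a q
    + c 4 * (cu a q * cu a q) + c 5 * (cu a q * cv a q) + c 6 * (cv a q * cv a q)

theorem hasGrad_poly {a : ℝ} {p : Vec} (hp : p ∈ domain a) (c : Fin 7 → ℝ) :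
    HasGrad (poly a c)
      ((c 1) • ![-2 * a * cu a p * cm a p, -2 * a * cv a p * cm a p, 0]
       + (c 2 + 2 * c 4 * cu a p + c 5 * cv a p) • ![cm a p - 2 * a * cu a p ^ 2, -2 * a * cu a p * cv a p, 0]
       + (c 3 + 2 * c 6 * cv a p + c 5 * cu a p) • ![-2 * a * cu a p * cv a p, cm a p - 2 * a * cv a p ^ 2, 0]) p := by
  have m := hasGrad_cm hp
  have u := hasGrad_cu hp
  have v := hasGrad_cv hp
  have k := fun i => HasGrad.const (c i) p
  have h := ((((((k 0).add ((k 1).mul m)).add ((k 2).mul u)).add ((k 3).mul v)).add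
    ((k 4).mul (u.mul u))).add ((k 5).mul (u.mul v))).add ((k 6).mul (v.mul v))
  refine ⟨h.1, fun i => (h.2 i).trans ?_⟩
  fin_cases i <;> simp <;> ring

/-! ### Christoffel symbols and curvature tensor -/

/-- The coefficients of the metric as functions of `1/λ`, `x/λ`, `y/λ`. -/
noncomputable def metricPoly (a b : ℝ) : Matrix (Fin 3) (Fin 3) (Fin 7 → ℝ) :=
  !![![0, 1, 0, 0, -a, 0, b ^ 2 / 4 - a], ![0, 0, 0, 0, 0, -b ^ 2 / 4, 0], ![0, 0, 0, b / 2, 0, 0, 0];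
    ![0, 0, 0, 0, 0, -b ^ 2 / 4, 0], ![0, 1, 0, 0, b ^ 2 / 4 - a, 0, -a], ![0, 0, -b / 2, 0, 0, 0, 0];
    ![0, 0, 0, b / 2, 0, 0, 0], ![0, 0, -b / 2, 0, 0, 0, 0], ![1, 0, 0, 0, 0, 0, 0]]

theorem metric_eq {a b : ℝ} {p : Vec} (hp : p ∈ domain a) (i j : Fin 3) :
    metric a b p i j = poly a (metricPoly a b i j) p := by
  have h := cm_sq hp
  have e : 1 / lam a p ^ 2 = cm a p - a * (cu a p ^ 2 + cv a p ^ 2) := by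
    rw [← h, cm]; simp
  have e0 : p 0 / lam a p = cu a p := rfl
  have e1 : p 1 / lam a p = cv a p := rfl
  fin_cases i <;> fin_cases j <;>
    simp [metric, form, poly, metricPoly, e0, e1] <;>
    (try simp only [one_div] at e; try rw [e]) <;> ring

theorem partialDeriv_of_eqOn {a : ℝ} {p : Vec} (hp : p ∈ domain a) {c : Fin 7 → ℝ} {f : Vec → ℝ}
    (hf : ∀ q ∈ domain a, f q = poly a c q) (i : Fin 3) :
    partialDeriv i f p =
      ((c 1) • ![-2 * a * cu a p * cm a p, -2 * a * cv a p * cm a p, 0]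
       + (c 2 + 2 * c 4 * cu a p + c 5 * cv a p)
          • ![cm a p - 2 * a * cu a p ^ 2, -2 * a * cu a p * cv a p, 0]
       + (c 3 + 2 * c 6 * cv a p + c 5 * cu a p)
          • ![-2 * a * cu a p * cv a p, cm a p - 2 * a * cv a p ^ 2, (0 : ℝ)]) i :=
  ((hasGrad_poly hp c).congr
    (Filter.eventually_of_mem ((isOpen_domain a).mem_nhds hp) hf)).2 i

theorem det_metric (a b : ℝ) (p : Vec) : (metric a b p).det = cm a p ^ 4 := by
  simp [Matrix.det_fin_three, metric, form, cm]
  ring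

/-- The Christoffel symbols as functions of `x/λ`, `y/λ`: the `k`-th matrix has the entries
`Γᵏᵢⱼ`. -/
noncomputable def chrPoly (a b : ℝ) : Fin 3 → Matrix (Fin 3) (Fin 3) (Fin 7 → ℝ) :=
  ![!![![0, 0, -2 * a, 0, 0, 0, 0], ![0, 0, 0, b ^ 2 / 4 - 2 * a, 0, 0, 0], 0;
      ![0, 0, 0, b ^ 2 / 4 - 2 * a, 0, 0, 0], ![0, 0, 2 * a - b ^ 2 / 2, 0, 0, 0, 0],
        ![b / 2, 0, 0, 0, 0, 0, 0];
      0, ![b / 2, 0, 0, 0, 0, 0, 0], 0],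
    !![![0, 0, 0, 2 * a - b ^ 2 / 2, 0, 0, 0], ![0, 0, b ^ 2 / 4 - 2 * a, 0, 0, 0, 0],
        ![-b / 2, 0, 0, 0, 0, 0, 0];
      ![0, 0, b ^ 2 / 4 - 2 * a, 0, 0, 0, 0], ![0, 0, 0, -2 * a, 0, 0, 0], 0;
      ![-b / 2, 0, 0, 0, 0, 0, 0], 0, 0],
    !![![0, 0, 0, 0, 0, b / 2 * (2 * a - b ^ 2 / 2), 0],
        ![0, 0, 0, 0, b / 2 * (b ^ 2 / 4 - a), 0, b / 2 * (a - b ^ 2 / 4)],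
        ![0, 0, -b ^ 2 / 4, 0, 0, 0, 0];
      ![0, 0, 0, 0, b / 2 * (b ^ 2 / 4 - a), 0, b / 2 * (a - b ^ 2 / 4)],
        ![0, 0, 0, 0, 0, b / 2 * (b ^ 2 / 2 - 2 * a), 0], ![0, 0, 0, -b ^ 2 / 4, 0, 0, 0];
      ![0, 0, -b ^ 2 / 4, 0, 0, 0, 0], ![0, 0, 0, -b ^ 2 / 4, 0, 0, 0], 0]]

/-- The inverse metric is never computed: lowering the upper index turns the claim into polynomial
identities (`key`), and invertibility of the metric raises it back. -/
theorem christoffel_eq {a b : ℝ} {p : Vec} (hp : p ∈ domain a) (k i j : Fin 3) :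
    christoffel (metric a b) k i j p = poly a (chrPoly a b k i j) p := by
  have hdet : IsUnit (metric a b p).det := by
    rw [det_metric]; exact (pow_pos (cm_pos hp) 4).ne'.isUnit
  have hd : ∀ l m n : Fin 3, partialDeriv l (fun q => metric a b q m n) p = _ :=
    fun l m n => partialDeriv_of_eqOn hp (fun q hq => metric_eq hq m n) l
  have key : ∀ l, (metric a b p *ᵥ fun k => poly a (chrPoly a b k i j) p) l = (1 / 2 : ℝ) *
      (partialDeriv i (fun q => metric a b q j l) p + partialDeriv j (fun q => metric a b q i l) p
      - partialDeriv l (fun q => metric a b q i j) p) := by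
    intro l
    simp only [hd, Matrix.mulVec, dotProduct, metric_eq hp, Fin.sum_univ_three]
    fin_cases i <;> fin_cases j <;> fin_cases l <;>
      simp [poly, chrPoly, metricPoly] <;> ring
  have e : (fun k => poly a (chrPoly a b k i j) p) = (metric a b p)⁻¹ *ᵥ fun l => (1 / 2 : ℝ) *
      (partialDeriv i (fun q => metric a b q j l) p + partialDeriv j (fun q => metric a b q i l) p
      - partialDeriv l (fun q => metric a b q i j) p) := by
    rw [← funext key, Matrix.mulVec_mulVec, Matrix.nonsing_inv_mul _ hdet, Matrix.one_mulVec]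
  rw [congrFun e k, christoffel, Finset.mul_sum]
  simp only [Matrix.mulVec, dotProduct]
  exact Finset.sum_congr rfl fun l _ => by ring

/-- The components of the one-form `form a b p` in terms of `x/λ`, `y/λ`. -/
theorem form_eq (a b : ℝ) (p : Vec) : form a b p = ![b / 2 * cv a p, -(b / 2 * cu a p), 1] := rfl

-- A constant-curvature tensor plus a correction built from `E₃` and its metric dual, the one-form
-- `form`. In terms of `1/λ`, `x/λ`, `y/λ`, each of the 81 components is a polynomial identity.
set_option maxHeartbeats 4000000 in
theorem curvatureCoeff_eq {a b : ℝ} {p : Vec} (hp : p ∈ domain a) (l k i j : Fin 3) :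
    curvatureCoeff (metric a b) l k i j p =
      (4 * a - 3 * b ^ 2 / 4) * (metric a b p j k * (1 : Matrix (Fin 3) (Fin 3) ℝ) l i
        - metric a b p i k * (1 : Matrix (Fin 3) (Fin 3) ℝ) l j)
      + (b ^ 2 - 4 * a) * (form a b p j * form a b p k * (1 : Matrix (Fin 3) (Fin 3) ℝ) l i
        - form a b p i * form a b p k * (1 : Matrix (Fin 3) (Fin 3) ℝ) l j
        + metric a b p j k * form a b p i * E₃ l - metric a b p i k * form a b p j * E₃ l) := by
  have hd : ∀ l m n o : Fin 3, partialDeriv l (christoffel (metric a b) m n o) p = _ :=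
    fun l m n o => partialDeriv_of_eqOn hp (fun q hq => christoffel_eq hq m n o) l
  simp only [curvatureCoeff, hd, christoffel_eq hp, metric_eq hp, form_eq, E₃, Fin.sum_univ_three]
  fin_cases l <;> fin_cases i <;> fin_cases j <;> fin_cases k <;>
    simp [poly, chrPoly, metricPoly] <;> ring

/-! ### Passage to the orthonormal frame -/

/-- The components of the tangent vector `V` at `p` in the orthonormal frame dual to
`dx / λ`, `dy / λ`, `dz + (b/2) (y dx - x dy) / λ`. -/
noncomputable def fr (a b : ℝ) (p V : Vec) : Vec :=
  ![cm a p * V 0, cm a p * V 1, V 2 + b / 2 * (cv a p * V 0 - cu a p * V 1)]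

theorem fr_smul (a b : ℝ) (p : Vec) (c : ℝ) (V : Vec) : fr a b p (c • V) = c • fr a b p V := by
  ext i; fin_cases i <;> simp [fr] <;> ring

theorem fr_add (a b : ℝ) (p V W : Vec) : fr a b p (V + W) = fr a b p V + fr a b p W := by
  ext i; fin_cases i <;> simp [fr] <;> ring

theorem fr_sub (a b : ℝ) (p V W : Vec) : fr a b p (V - W) = fr a b p V - fr a b p W := by
  ext i; fin_cases i <;> simp [fr] <;> ring

theorem fr_zero (a b : ℝ) (p : Vec) : fr a b p 0 = 0 := by
  ext i; fin_cases i <;> simp [fr]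

theorem fr_E₃ (a b : ℝ) (p : Vec) : fr a b p E₃ = E₃ := by
  ext i; fin_cases i <;> simp [fr, E₃]

theorem form_dotProduct (a b : ℝ) (p V : Vec) : form a b p ⬝ᵥ V = fr a b p V 2 := by
  simp [form_eq, fr, dotProduct, Fin.sum_univ_three]; ring

theorem eq_zero_of_fr_eq_zero {a b : ℝ} {p V : Vec} (hp : p ∈ domain a) (h : fr a b p V = 0) :
    V = 0 := by
  have hm := (cm_pos hp).ne'
  have h0 : V 0 = 0 := by simpa [fr, hm] using congrFun h 0
  have h1 : V 1 = 0 := by simpa [fr, hm] using congrFun h 1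
  have h2 : V 2 = 0 := by simpa [fr, h0, h1] using congrFun h 2
  ext i; fin_cases i <;> assumption

theorem metric_mulVec (a b : ℝ) (p V : Vec) :
    metric a b p *ᵥ V = ![cm a p * fr a b p V 0 + b / 2 * cv a p * fr a b p V 2,
      cm a p * fr a b p V 1 - b / 2 * cu a p * fr a b p V 2, fr a b p V 2] := by
  ext i
  fin_cases i <;>
    simp [Matrix.mulVec, dotProduct, Fin.sum_univ_three, metric, form, fr, cm, cu, cv] <;> ring

theorem ip_metric (a b : ℝ) (p V W : Vec) :
    ip (metric a b) p V W = fr a b p V ⬝ᵥ fr a b p W := by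
  have h : ip (metric a b) p V W = V ⬝ᵥ (metric a b p *ᵥ W) := by
    simp [ip, dotProduct, Matrix.mulVec, Fin.sum_univ_three]; ring
  rw [h, metric_mulVec]
  simp [dotProduct, Fin.sum_univ_three, fr]; ring

/-- The frame is orthonormal and positively oriented, its coordinate change having determinant
`(1/λ)² = √det g > 0`. -/
theorem fr_cross {a b : ℝ} {p : Vec} (hp : p ∈ domain a) (V W : Vec) :
    fr a b p (cross (metric a b) p V W) = fr a b p V ⨯₃ fr a b p W := by
  have hm := cm_pos hp
  have hdet : IsUnit (metric a b p).det := by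
    rw [det_metric]; exact (pow_pos hm 4).ne'.isUnit
  have hs : Real.sqrt (metric a b p).det = cm a p ^ 2 := by
    rw [det_metric, show cm a p ^ 4 = (cm a p ^ 2) ^ 2 by ring]
    exact Real.sqrt_sq (by positivity)
  have h : metric a b p *ᵥ ((metric a b p)⁻¹ *ᵥ (V ⨯₃ W)) = V ⨯₃ W := by
    rw [Matrix.mulVec_mulVec, Matrix.mul_nonsing_inv _ hdet, Matrix.one_mulVec]
  rw [cross, hs, fr_smul]
  generalize (metric a b p)⁻¹ *ᵥ (V ⨯₃ W) = X at h
  rw [metric_mulVec] at h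
  have h0 := congrFun h 0
  have h1 := congrFun h 1
  have h2 := congrFun h 2
  simp only [cross_apply, Matrix.cons_val_zero, Matrix.cons_val_one, Matrix.cons_val] at h0 h1 h2
  generalize fr a b p X = Y at *
  ext i
  fin_cases i <;> simp [fr, cross_apply]
  · linear_combination cm a p * h0 - cm a p * b / 2 * cv a p * h2
  · linear_combination cm a p * h1 + cm a p * b / 2 * cu a p * h2
  · linear_combination cm a p ^ 2 * h2

theorem riemann_metric {a b : ℝ} {p : Vec} (hp : p ∈ domain a) (X Y Z : Vec) :
    riemann (metric a b) p X Y Z =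
      (4 * a - 3 * b ^ 2 / 4) • (ip (metric a b) p Y Z • X - ip (metric a b) p X Z • Y)
      + (b ^ 2 - 4 * a) • ((form a b p ⬝ᵥ Y * form a b p ⬝ᵥ Z) • X
        - (form a b p ⬝ᵥ X * form a b p ⬝ᵥ Z) • Y
        + (ip (metric a b) p Y Z * form a b p ⬝ᵥ X) • E₃
        - (ip (metric a b) p X Z * form a b p ⬝ᵥ Y) • E₃) := by
  ext l
  simp only [riemann, curvatureCoeff_eq hp, ip, Fin.sum_univ_three, dotProduct, Pi.add_apply,
    Pi.sub_apply, Pi.smul_apply, smul_eq_mul]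
  generalize metric a b p = g
  generalize form a b p = f
  fin_cases l <;> simp [Matrix.one_apply] <;> ring

/-- The curvature tensor of `metric a b` in the orthonormal frame. -/
noncomputable def frRiemann (a b : ℝ) (X Y Z : Vec) : Vec :=
  (4 * a - 3 * b ^ 2 / 4) • ((Y ⬝ᵥ Z) • X - (X ⬝ᵥ Z) • Y)
    + (b ^ 2 - 4 * a) • ((Y 2 * Z 2) • X - (X 2 * Z 2) • Y + ((Y ⬝ᵥ Z) * X 2) • E₃
      - ((X ⬝ᵥ Z) * Y 2) • E₃)

theorem fr_riemann {a b : ℝ} {p : Vec} (hp : p ∈ domain a) (X Y Z : Vec) :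
    fr a b p (riemann (metric a b) p X Y Z) =
      frRiemann a b (fr a b p X) (fr a b p Y) (fr a b p Z) := by
  simp only [riemann_metric hp, fr_add, fr_sub, fr_smul, fr_E₃, ip_metric, form_dotProduct,
    frRiemann]

/-! ### Covariant derivatives in the frame -/

/-- `w` is the derivative of `v` at `s` for the connection `∇ v = v' + Ω × v`. -/
def HasCov (Ω v w : ℝ → Vec) (s : ℝ) : Prop := HasDerivAt v (w s - Ω s ⨯₃ v s) s

/-- The angular velocity of the frame along `γ`. -/
noncomputable def angular (a b : ℝ) (γ : ℝ → Vec) (s : ℝ) : Vec :=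
  ![b / 2 * fr a b (γ s) (deriv γ s) 0, b / 2 * fr a b (γ s) (deriv γ s) 1,
    -(b / 2 * fr a b (γ s) (deriv γ s) 2)
      + 2 * a * (cv a (γ s) * deriv γ s 0 - cu a (γ s) * deriv γ s 1)]

/-- Metric compatibility makes the connection matrix in an orthonormal frame skew, hence a cross
product in dimension 3. -/
theorem hasCov_fr {a b : ℝ} {γ V : ℝ → Vec} {s : ℝ} (hs : γ s ∈ domain a)
    (hγ : DifferentiableAt ℝ γ s) (hV : DifferentiableAt ℝ V s) :
    HasCov (angular a b γ) (fun s => fr a b (γ s) (V s))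
      (fun s => fr a b (γ s) (covDeriv (metric a b) γ V s)) s := by
  have hm := (hasFDerivAt_cm hs).comp_hasDerivAt s hγ.hasDerivAt
  have hu := (hasFDerivAt_cu hs).comp_hasDerivAt s hγ.hasDerivAt
  have hv := (hasFDerivAt_cv hs).comp_hasDerivAt s hγ.hasDerivAt
  have hV' := hasDerivAt_pi.1 hV.hasDerivAt
  have hsq := cm_sq hs
  rw [HasCov, hasDerivAt_pi]
  intro i
  have h0 := hm.mul (hV' 0)
  have h1 := hm.mul (hV' 1)
  have h2 := (hV' 2).add (((hv.mul (hV' 0)).sub (hu.mul (hV' 1))).const_mul (b / 2))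
  fin_cases i
  · refine HasDerivAt.congr_deriv (f := fun s => fr a b (γ s) (V s) 0) h0 ?_
    simp [covDeriv, christoffel_eq hs, Fin.sum_univ_three, poly, chrPoly, angular, fr, cross_apply]
    ring
  · refine HasDerivAt.congr_deriv (f := fun s => fr a b (γ s) (V s) 1) h1 ?_
    simp [covDeriv, christoffel_eq hs, Fin.sum_univ_three, poly, chrPoly, angular, fr, cross_apply]
    ring
  · refine HasDerivAt.congr_deriv (f := fun s => fr a b (γ s) (V s) 2) h2 ?_
    simp [covDeriv, christoffel_eq hs, Fin.sum_univ_three, poly, chrPoly, angular, fr, cross_apply]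
    linear_combination b / 2 * (deriv γ s 0 * V s 1 - deriv γ s 1 * V s 0) * hsq

/-- Since `E₃` has constant components, its covariant derivative is `Ω × E₃`, and the horizontal
part of `Ω` is `b/2` times that of `T`. -/
theorem hasCov_E₃ (a b : ℝ) (γ : ℝ → Vec) (s : ℝ) :
    HasCov (angular a b γ) (fun _ => E₃)
      (fun s => (b / 2) • (fr a b (γ s) (deriv γ s) ⨯₃ E₃)) s := by
  refine (hasDerivAt_const s E₃).congr_deriv ?_
  ext i
  fin_cases i <;> simp [angular, cross_apply, E₃]

/-! ### Smoothness -/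

theorem contDiffOn_cm (a : ℝ) : ContDiffOn ℝ ∞ (cm a) (domain a) := by
  refine ContDiffOn.inv ?_ fun p hp => ne_of_gt hp
  unfold lam; fun_prop

theorem contDiffOn_cu (a : ℝ) : ContDiffOn ℝ ∞ (cu a) (domain a) := by
  refine ContDiffOn.div (by fun_prop) ?_ fun p hp => ne_of_gt hp
  unfold lam; fun_prop

theorem contDiffOn_cv (a : ℝ) : ContDiffOn ℝ ∞ (cv a) (domain a) := by
  refine ContDiffOn.div (by fun_prop) ?_ fun p hp => ne_of_gt hp
  unfold lam; fun_prop

theorem contDiffOn_christoffel (a b : ℝ) (k i j : Fin 3) :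
    ContDiffOn ℝ ∞ (christoffel (metric a b) k i j) (domain a) := by
  have hm := contDiffOn_cm a
  have hu := contDiffOn_cu a
  have hv := contDiffOn_cv a
  refine ContDiffOn.congr (f := poly a (chrPoly a b k i j)) ?_ fun p hp => christoffel_eq hp k i j
  unfold poly
  fun_prop

section Curve

variable {a b : ℝ} {I J : Set ℝ} {γ : ℝ → Vec}

theorem contDiffOn_deriv {F : Type*} [NormedAddCommGroup F] [NormedSpace ℝ F] {f : ℝ → F}
    (hJ : IsOpen J) (hf : ContDiffOn ℝ ∞ f J) : ContDiffOn ℝ ∞ (deriv f) J :=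
  hf.deriv_of_isOpen hJ (by simp)

theorem contDiffOn_fr {V : ℝ → Vec} (hγ : ContDiffOn ℝ ∞ γ J) (hmaps : Set.MapsTo γ J (domain a))
    (hV : ContDiffOn ℝ ∞ V J) : ContDiffOn ℝ ∞ (fun s => fr a b (γ s) (V s)) J := by
  have hm := (contDiffOn_cm a).comp hγ hmaps
  have hu := (contDiffOn_cu a).comp hγ hmaps
  have hv := (contDiffOn_cv a).comp hγ hmaps
  have hV' := contDiffOn_pi.1 hV
  have h0 := hV' 0
  have h1 := hV' 1
  have h2 := hV' 2
  rw [contDiffOn_pi]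
  intro i
  fin_cases i
  · exact hm.mul h0
  · exact hm.mul h1
  · exact h2.add (contDiffOn_const.mul ((hv.mul h0).sub (hu.mul h1)))

theorem contDiffOn_covDeriv {V : ℝ → Vec} (hJ : IsOpen J) (hγ : ContDiffOn ℝ ∞ γ J)
    (hmaps : Set.MapsTo γ J (domain a)) (hV : ContDiffOn ℝ ∞ V J) :
    ContDiffOn ℝ ∞ (covDeriv (metric a b) γ V) J := by
  have hV' := contDiffOn_pi.1 hV
  have hdV := contDiffOn_pi.1 (contDiffOn_deriv hJ hV)
  have hdγ := contDiffOn_pi.1 (contDiffOn_deriv hJ hγ)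
  rw [contDiffOn_pi]
  intro k
  refine (hdV k).add (ContDiffOn.sum fun i _ => ContDiffOn.sum fun j _ => ?_)
  exact (((contDiffOn_christoffel a b k i j).comp hγ hmaps).mul (hdγ i)).mul (hV' j)

theorem contDiffOn_covT (hJ : IsOpen J) (hγ : ContDiffOn ℝ ∞ γ J)
    (hmaps : Set.MapsTo γ J (domain a)) (m : ℕ) :
    ContDiffOn ℝ ∞ (covT (metric a b) γ m) J := by
  induction m with
  | zero => exact contDiffOn_deriv hJ hγ
  | succ m ih =>
    have : covT (metric a b) γ (m + 1) = covDeriv (metric a b) γ (covT (metric a b) γ m) :=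
      Function.iterate_succ_apply' _ _ _
    rw [this]
    exact contDiffOn_covDeriv hJ hγ hmaps ih

theorem hasCov_covT (b : ℝ) (hJ : IsOpen J) (hγ : ContDiffOn ℝ ∞ γ J)
    (hmaps : Set.MapsTo γ J (domain a)) (m : ℕ) {s : ℝ} (hs : s ∈ J) :
    HasCov (angular a b γ) (fun s => fr a b (γ s) (covT (metric a b) γ m s))
      (fun s => fr a b (γ s) (covT (metric a b) γ (m + 1) s)) s := by
  have h1 := (hγ.contDiffAt (hJ.mem_nhds hs)).differentiableAt (by simp)
  have h2 := ((contDiffOn_covT (b := b) hJ hγ hmaps m).contDiffAt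
    (hJ.mem_nhds hs)).differentiableAt (by simp)
  have : covT (metric a b) γ (m + 1) = covDeriv (metric a b) γ (covT (metric a b) γ m) :=
    Function.iterate_succ_apply' _ _ _
  rw [this]
  exact hasCov_fr (hmaps hs) h1 h2

end Curve

/-! ### The scalar system -/

section Scalar

variable {J : Set ℝ}

theorem constant_of_hasDerivAt_zero (hJ : IsOpen J) (hc : IsPreconnected J) {f f' : ℝ → ℝ}
    (hf : ∀ s ∈ J, HasDerivAt f (f' s) s) (h0 : ∀ s ∈ J, f' s = 0) {s t : ℝ} (hs : s ∈ J)
    (ht : t ∈ J) : f s = f t :=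
  hJ.is_const_of_deriv_eq_zero hc (fun x hx => (hf x hx).differentiableAt.differentiableWithinAt)
    (fun x hx => by rw [(hf x hx).deriv, h0 x hx]; rfl) hs ht

theorem deriv_eq_of_eqOn (hJ : IsOpen J) {f h : ℝ → ℝ} {f' h' s : ℝ} (hs : s ∈ J)
    (hf : HasDerivAt f f' s) (hh : HasDerivAt h h' s) (e : ∀ x ∈ J, f x = h x) : f' = h' :=
  hf.unique (hh.congr_of_eventuallyEq (Filter.eventually_of_mem (hJ.mem_nhds hs) e))

open Polynomial in
/-- A polynomial of degree ten (with coefficients depending on parameters) has finitely many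
zeros. -/
theorem finite_zeros (c d K : ℝ) :
    {x : ℝ | -(126 / 25) * x ^ 10 - 8 / 5 * K * x ^ 8 - 126 / 5 * d * x ^ 6 - 42 / 5 * c * x ^ 5
      - c * K / 2 * x ^ 3 - 6 * c * d * x - 7 / 2 * c ^ 2 = 0}.Finite := by
  set Q : ℝ[X] := C (-(126 / 25)) * X ^ 10 - C (8 / 5 * K) * X ^ 8 - C (126 / 5 * d) * X ^ 6
    - C (42 / 5 * c) * X ^ 5 - C (c * K / 2) * X ^ 3 - C (6 * c * d) * X ^ 1 - C (7 / 2 * c ^ 2)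
    with hQ
  have hne : Q ≠ 0 := by
    intro h
    have := congrArg (fun q => coeff q 10) h
    simp only [hQ, coeff_sub, coeff_C_mul, coeff_X_pow, coeff_C, coeff_zero] at this
    norm_num at this
  refine (Q.finite_setOfPred_isRoot hne).subset fun x hx => ?_
  rw [Set.mem_ofPred_eq] at hx ⊢
  simp only [IsRoot, hQ, eval_sub, eval_mul, eval_C, eval_pow, eval_X, pow_one]
  exact hx

variable {k k₁ k₂ k₃ k₄ : ℝ → ℝ}

/-- Where the tangential and normal components of the triharmonic equation of a curve without
torsion hold, with a constant sectional curvature `K`, the curvature `k` is constant. -/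
theorem curvature_constant (hJ : IsOpen J) (hc : IsPreconnected J)
    (h₀ : ∀ s ∈ J, HasDerivAt k (k₁ s) s) (h₁ : ∀ s ∈ J, HasDerivAt k₁ (k₂ s) s)
    (h₂ : ∀ s ∈ J, HasDerivAt k₂ (k₃ s) s) (h₃ : ∀ s ∈ J, HasDerivAt k₃ (k₄ s) s)
    (hT : ∀ s ∈ J, k s * k₃ s + 2 * k₁ s * k₂ s - 2 * k s ^ 3 * k₁ s = 0) (K : ℝ)
    (hN : ∀ s ∈ J, k₄ s - 15 * k s * k₁ s ^ 2 - 10 * k s ^ 2 * k₂ s + k s ^ 5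
      + (k₂ s - 2 * k s ^ 3) * K = 0) {s t : ℝ} (hs : s ∈ J) (ht : t ∈ J) : k s = k t := by
  -- The tangential equation is exactly the derivative of this expression.
  obtain ⟨d, hd⟩ : ∃ d, ∀ x ∈ J, k x * k₂ x + k₁ x ^ 2 / 2 - k x ^ 4 / 2 = d :=
    ⟨_, fun x hx => constant_of_hasDerivAt_zero hJ hc (fun y hy => (((h₀ y hy).mul (h₂ y hy)).add
      (((h₁ y hy).pow 2).div_const 2)).sub (((h₀ y hy).pow 4).div_const 2))
      (fun y hy => by simp; linear_combination hT y hy) hx hs⟩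
  -- Multiplying the first integral by the integrating factor `2k'` gives a second one.
  obtain ⟨c, hc'⟩ : ∃ c, ∀ x ∈ J, k x * k₁ x ^ 2 - k x ^ 5 / 5 - 2 * d * k x = c :=
    ⟨_, fun x hx => constant_of_hasDerivAt_zero hJ hc (fun y hy => (((h₀ y hy).mul
      ((h₁ y hy).pow 2)).sub (((h₀ y hy).pow 5).div_const 5)).sub ((h₀ y hy).const_mul (2 * d)))
      (fun y hy => by simp; linear_combination 2 * k₁ y * hd y hy) hx hs⟩
  have hT' : ∀ x ∈ J, k x * k₄ x + 3 * k₁ x * k₃ x + 2 * k₂ x ^ 2 - 6 * k x ^ 2 * k₁ x ^ 2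
      - 2 * k x ^ 3 * k₂ x = 0 := fun x hx => by
    have := deriv_eq_of_eqOn hJ hx ((((h₀ x hx).mul (h₃ x hx)).add
      (((h₁ x hx).const_mul 2).mul (h₂ x hx))).sub ((((h₀ x hx).pow 3).const_mul 2).mul (h₁ x hx)))
      (hasDerivAt_const x 0) hT
    simp at this
    linear_combination this
  -- The integrals give `k k'²` and `k² k''` in terms of `k`, and the differentiated tangential
  -- equation gives `k⁵ k''''`. Substitution into `k⁵` times the normal equation leaves a polynomial
  -- in `k` with leading coefficient `-126/25`. A connected set of real numbers that is finite has
  -- at most one point.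
  have hfin : (k '' J).Finite := by
    refine (finite_zeros c d K).subset ?_
    rintro _ ⟨x, hx, rfl⟩
    rw [Set.mem_ofPred_eq]
    have e1 := hd x hx
    have e2 := hc' x hx
    have e3 := hT x hx
    have e4 := hT' x hx
    have e5 := hN x hx
    generalize k x = y at *
    generalize k₁ x = y₁ at *
    generalize k₂ x = y₂ at *
    generalize k₃ x = y₃ at *
    generalize k₄ x = y₄ at *
    have p : y * y₁ ^ 2 = y ^ 5 / 5 + 2 * d * y + c := by linear_combination e2
    have q : y ^ 2 * y₂ = 2 / 5 * y ^ 5 - c / 2 := by linear_combination y * e1 - p / 2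
    have r : y ^ 2 * y₄ = 6 * y₁ ^ 2 * y₂ - 2 * y * y₂ ^ 2 + 2 * y ^ 4 * y₂ := by
      linear_combination y * e4 - 3 * y₁ * e3
    have r' : y ^ 5 * y₄ = 6 * (y ^ 5 / 5 + 2 * d * y + c) * (2 / 5 * y ^ 5 - c / 2)
        - 2 * (2 / 5 * y ^ 5 - c / 2) ^ 2 + 2 * y ^ 5 * (2 / 5 * y ^ 5 - c / 2) := by
      rw [← p, ← q]; linear_combination y ^ 3 * r
    linear_combination y ^ 5 * e5 - r' + 15 * y ^ 5 * p + 10 * y ^ 5 * q - K * y ^ 3 * q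
  by_contra hne
  exact (hc.image k fun x hx => (h₀ x hx).continuousAt.continuousWithinAt).infinite_of_nontrivial
    ⟨k s, ⟨s, hs, rfl⟩, k t, ⟨t, ht, rfl⟩, hne⟩ hfin

theorem sq_of_curvature_constant (hJ : IsOpen J)
    (h₀ : ∀ s ∈ J, HasDerivAt k (k₁ s) s) (h₁ : ∀ s ∈ J, HasDerivAt k₁ (k₂ s) s)
    (h₂ : ∀ s ∈ J, HasDerivAt k₂ (k₃ s) s) (h₃ : ∀ s ∈ J, HasDerivAt k₃ (k₄ s) s) {K : ℝ}
    (hc : ∀ s ∈ J, ∀ t ∈ J, k s = k t) {s : ℝ} (hs : s ∈ J) (h0 : k s ≠ 0)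
    (hN : k₄ s - 15 * k s * k₁ s ^ 2 - 10 * k s ^ 2 * k₂ s + k s ^ 5
      + (k₂ s - 2 * k s ^ 3) * K = 0) : k s ^ 2 = 2 * K := by
  have z₁ : ∀ x ∈ J, k₁ x = 0 := fun x hx =>
    deriv_eq_of_eqOn hJ hx (h₀ x hx) (hasDerivAt_const x (k x)) fun y hy => hc y hy x hx
  have z₂ : ∀ x ∈ J, k₂ x = 0 := fun x hx =>
    deriv_eq_of_eqOn hJ hx (h₁ x hx) (hasDerivAt_const x 0) z₁
  have z₃ : ∀ x ∈ J, k₃ x = 0 := fun x hx =>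
    deriv_eq_of_eqOn hJ hx (h₂ x hx) (hasDerivAt_const x 0) z₂
  have z₄ : k₄ s = 0 := deriv_eq_of_eqOn hJ hs (h₃ s hs) (hasDerivAt_const s 0) z₃
  rw [z₁ s hs, z₂ s hs, z₄] at hN
  exact mul_left_cancel₀ (pow_ne_zero 3 h0) (by linear_combination hN)

/-- The tangential component of the triharmonic equation excludes `k'' = 2 k³ ≠ 0` on an open set. -/
theorem eq_zero_of_binormal_equation (hJ : IsOpen J)
    (h₀ : ∀ s ∈ J, HasDerivAt k (k₁ s) s) (h₁ : ∀ s ∈ J, HasDerivAt k₁ (k₂ s) s)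
    (h₂ : ∀ s ∈ J, HasDerivAt k₂ (k₃ s) s) (hne : ∀ s ∈ J, k s ≠ 0)
    (hT : ∀ s ∈ J, k s * k₃ s + 2 * k₁ s * k₂ s - 2 * k s ^ 3 * k₁ s = 0) {f : ℝ → ℝ}
    (hf : ContinuousOn f J) (hB : ∀ s ∈ J, (k₂ s - 2 * k s ^ 3) * f s = 0) :
    ∀ s ∈ J, f s = 0 := by
  intro s hs
  by_contra hfs
  have hU : IsOpen (J ∩ f ⁻¹' {0}ᶜ) := hf.isOpen_inter_preimage hJ isOpen_compl_singleton
  have e₂ : ∀ x ∈ J ∩ f ⁻¹' {0}ᶜ, k₂ x = 2 * k x ^ 3 := fun x hx =>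
    sub_eq_zero.1 ((mul_eq_zero.1 (hB x hx.1)).resolve_right hx.2)
  -- Differentiating `k'' = 2k³` gives `k''' = 6k²k'`, which turns the tangential equation into
  -- `8k³k' = 0`.
  have e₁ : ∀ x ∈ J ∩ f ⁻¹' {0}ᶜ, k₁ x = 0 := fun x hx => by
    have e₃ := deriv_eq_of_eqOn hU hx (h₂ x hx.1) (((h₀ x hx.1).pow 3).const_mul 2) e₂
    have h := hT x hx.1
    simp at e₃
    rw [e₃, e₂ x hx] at h
    have : 8 * k x ^ 3 * k₁ x = 0 := by linear_combination h
    simpa [hne x hx.1] using this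
  have h := deriv_eq_of_eqOn hU ⟨hs, hfs⟩ (h₁ s hs) (hasDerivAt_const s 0) e₁
  rw [e₂ s ⟨hs, hfs⟩] at h
  exact hne s hs (by simpa using h)

end Scalar

/-! ### Calculus of `HasCov` -/

section Cov

variable {Ω v v' w w' : ℝ → Vec} {s : ℝ}

theorem HasCov.apply (hv : HasCov Ω v v' s) (i : Fin 3) :
    HasDerivAt (fun s => v s i) (v' s i - (Ω s ⨯₃ v s) i) s := by
  simpa using hasDerivAt_pi.1 hv i

/-- The `Ω` terms cancel by skewness of the triple product; in `HasCov.cross` they combine by the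
Jacobi identity. -/
theorem HasCov.dot (hv : HasCov Ω v v' s) (hw : HasCov Ω w w' s) :
    HasDerivAt (fun s => v s ⬝ᵥ w s) (v' s ⬝ᵥ w s + v s ⬝ᵥ w' s) s := by
  have h := (((hv.apply 0).mul (hw.apply 0)).add ((hv.apply 1).mul (hw.apply 1))).add
    ((hv.apply 2).mul (hw.apply 2))
  simp only [dotProduct, Fin.sum_univ_three]
  refine HasDerivAt.congr_deriv h ?_
  simp [cross_apply]
  ring

theorem HasCov.smul (hv : HasCov Ω v v' s) {f f' : ℝ → ℝ} (hf : HasDerivAt f (f' s) s) :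
    HasCov Ω (fun s => f s • v s) (fun s => f' s • v s + f s • v' s) s := by
  refine (HasDerivAt.smul hf hv).congr_deriv ?_
  ext i
  simp only [map_smul, Pi.add_apply, Pi.sub_apply, Pi.smul_apply, smul_eq_mul]
  ring

theorem HasCov.add (hv : HasCov Ω v v' s) (hw : HasCov Ω w w' s) :
    HasCov Ω (fun s => v s + w s) (fun s => v' s + w' s) s := by
  refine (HasDerivAt.add hv hw).congr_deriv ?_
  ext i
  simp only [map_add, Pi.add_apply, Pi.sub_apply]
  ring

theorem HasCov.cross (hv : HasCov Ω v v' s) (hw : HasCov Ω w w' s) :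
    HasCov Ω (fun s => v s ⨯₃ w s) (fun s => v' s ⨯₃ w s + v s ⨯₃ w' s) s := by
  rw [HasCov, hasDerivAt_pi]
  have m := fun i j => (hv.apply i).mul (hw.apply j)
  intro i
  fin_cases i
  · refine ((m 1 2).sub (m 2 1)).congr_deriv ?_
    simp [cross_apply]; ring
  · refine ((m 2 0).sub (m 0 2)).congr_deriv ?_
    simp [cross_apply]; ring
  · refine ((m 0 1).sub (m 1 0)).congr_deriv ?_
    simp [cross_apply]; ring

theorem HasCov.unique (hv : HasCov Ω v v' s) (hw : HasCov Ω w w' s) {J : Set ℝ} (hJ : IsOpen J)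
    (hs : s ∈ J) (e : ∀ x ∈ J, v x = w x) : v' s = w' s := by
  have h := HasDerivAt.unique hv
    (HasDerivAt.congr_of_eventuallyEq hw (Filter.eventually_of_mem (hJ.mem_nhds hs) e))
  rw [e s hs] at h
  exact sub_left_injective h

theorem HasCov.congr (hv : HasCov Ω v v' s) (e : v' s = w' s) : HasCov Ω v w' s := by
  rw [HasCov, ← e]; exact hv

end Cov

/-! ### Frenet frame and components of the triharmonic equation -/

theorem dot_E₃ (v : Vec) : v ⬝ᵥ E₃ = v 2 := by simp [dotProduct, Fin.sum_univ_three, E₃]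

/-- Expansion in the orthonormal basis `T`, `N`, `T × N`. -/
theorem orthonormal_expansion {T N : Vec} (hT : T ⬝ᵥ T = 1) (hN : N ⬝ᵥ N = 1) (hTN : T ⬝ᵥ N = 0)
    (v : Vec) : v = (v ⬝ᵥ T) • T + (v ⬝ᵥ N) • N + (v ⬝ᵥ (T ⨯₃ N)) • (T ⨯₃ N) := by
  simp only [dotProduct, Fin.sum_univ_three] at hT hN hTN
  -- With `B = T × N`, this uses `|B|² w = (w·B) B + B × (w × B)` and `w × B = (w·N) T - (w·T) N`.
  have key : ∀ w : Vec, w ⬝ᵥ T = 0 → w ⬝ᵥ N = 0 → w ⬝ᵥ (T ⨯₃ N) = 0 → w = 0 := by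
    intro w h1 h2 h3
    simp [dotProduct, Fin.sum_univ_three, cross_apply] at h1 h2 h3
    have hB : (T 1 * N 2 - T 2 * N 1) ^ 2 + (T 2 * N 0 - T 0 * N 2) ^ 2
        + (T 0 * N 1 - T 1 * N 0) ^ 2 = 1 := by
      linear_combination (N 0 * N 0 + N 1 * N 1 + N 2 * N 2) * hT + hN
        - (T 0 * N 0 + T 1 * N 1 + T 2 * N 2) * hTN
    ext i
    fin_cases i
    · simp
      linear_combination -w 0 * hB
        + ((T 2 * N 0 - T 0 * N 2) * T 2 - (T 0 * N 1 - T 1 * N 0) * T 1) * h2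
        - ((T 2 * N 0 - T 0 * N 2) * N 2 - (T 0 * N 1 - T 1 * N 0) * N 1) * h1
        + (T 1 * N 2 - T 2 * N 1) * h3
    · simp
      linear_combination -w 1 * hB
        + ((T 0 * N 1 - T 1 * N 0) * T 0 - (T 1 * N 2 - T 2 * N 1) * T 2) * h2
        - ((T 0 * N 1 - T 1 * N 0) * N 0 - (T 1 * N 2 - T 2 * N 1) * N 2) * h1
        + (T 2 * N 0 - T 0 * N 2) * h3
    · simp
      linear_combination -w 2 * hB
        + ((T 1 * N 2 - T 2 * N 1) * T 1 - (T 2 * N 0 - T 0 * N 2) * T 0) * h2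
        - ((T 1 * N 2 - T 2 * N 1) * N 1 - (T 2 * N 0 - T 0 * N 2) * N 0) * h1
        + (T 0 * N 1 - T 1 * N 0) * h3
  have hT' : T ⬝ᵥ T = 1 := by simpa [dotProduct, Fin.sum_univ_three] using hT
  have hN' : N ⬝ᵥ N = 1 := by simpa [dotProduct, Fin.sum_univ_three] using hN
  have hTN' : T ⬝ᵥ N = 0 := by simpa [dotProduct, Fin.sum_univ_three] using hTN
  have hNT' : N ⬝ᵥ T = 0 := by rw [dotProduct_comm]; exact hTN'
  have hB : (T ⨯₃ N) ⬝ᵥ (T ⨯₃ N) = 1 := by rw [cross_dot_cross]; simp [hT', hN', hTN']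
  have hBT : (T ⨯₃ N) ⬝ᵥ T = 0 := by rw [dotProduct_comm]; exact dot_self_cross T N
  have hBN : (T ⨯₃ N) ⬝ᵥ N = 0 := by rw [dotProduct_comm]; exact dot_cross_self T N
  refine sub_eq_zero.1 (key _ ?_ ?_ ?_) <;>
    simp [sub_dotProduct, add_dotProduct, smul_dotProduct, hT', hN', hTN', hNT', hB, hBT, hBN]

section Frenet

variable {a b : ℝ} {J : Set ℝ} {Ω T N N' : ℝ → Vec} {k : ℝ → ℝ}

theorem dot_tangent_normal (hJ : IsOpen J) (hTT : ∀ s ∈ J, T s ⬝ᵥ T s = 1)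
    (hk : ∀ s ∈ J, k s ≠ 0) (hT : ∀ s ∈ J, HasCov Ω T (fun s => k s • N s) s) :
    ∀ s ∈ J, T s ⬝ᵥ N s = 0 := by
  intro s hs
  have h := deriv_eq_of_eqOn hJ hs ((hT s hs).dot (hT s hs)) (hasDerivAt_const s 1) hTT
  rw [smul_dotProduct, dotProduct_smul, dotProduct_comm (N s)] at h
  simp at h
  exact h.resolve_left (hk s hs)

/-- The second Frenet equation of a curve without torsion. -/
theorem hasCov_normal (hJ : IsOpen J) (hTT : ∀ s ∈ J, T s ⬝ᵥ T s = 1)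
    (hNN : ∀ s ∈ J, N s ⬝ᵥ N s = 1) (hk : ∀ s ∈ J, k s ≠ 0)
    (hT : ∀ s ∈ J, HasCov Ω T (fun s => k s • N s) s) (hN : ∀ s ∈ J, HasCov Ω N N' s)
    (htor : ∀ s ∈ J, N' s ⬝ᵥ (T s ⨯₃ N s) = 0) :
    ∀ s ∈ J, HasCov Ω N (fun s => (-k s) • T s) s := by
  intro s hs
  have hTN := dot_tangent_normal hJ hTT hk hT
  have h1 := deriv_eq_of_eqOn hJ hs ((hN s hs).dot (hN s hs)) (hasDerivAt_const s 1) hNN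
  have h2 := deriv_eq_of_eqOn hJ hs ((hT s hs).dot (hN s hs)) (hasDerivAt_const s 0) hTN
  rw [dotProduct_comm (N s)] at h1
  rw [smul_dotProduct, hNN s hs, dotProduct_comm (T s)] at h2
  have h1' : N' s ⬝ᵥ N s = 0 := by linarith
  have h2' : N' s ⬝ᵥ T s = -k s := by simp at h2; linarith
  refine (hN s hs).congr ?_
  rw [orthonormal_expansion (hTT s hs) (hNN s hs) (hTN s hs) (N' s), h1', h2', htor s hs]
  simp

theorem hasCov_binormal {s : ℝ} (hT : HasCov Ω T (fun s => k s • N s) s)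
    (hN : HasCov Ω N (fun s => (-k s) • T s) s) : HasCov Ω (fun s => T s ⨯₃ N s) (fun _ => 0) s := by
  refine (hT.cross hN).congr ?_
  simp [cross_self]

/-- Covariant derivative of a field in the osculating plane. -/
theorem cov_osculating (hJ : IsOpen J) {v v' : ℝ → Vec} {f h f' h' : ℝ → ℝ} {s : ℝ} (hs : s ∈ J)
    (hT : HasCov Ω T (fun s => k s • N s) s) (hN : HasCov Ω N (fun s => (-k s) • T s) s)
    (hv : HasCov Ω v v' s) (e : ∀ x ∈ J, v x = f x • T x + h x • N x)
    (hf : HasDerivAt f (f' s) s) (hh : HasDerivAt h (h' s) s) :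
    v' s = (f' s - h s * k s) • T s + (h' s + f s * k s) • N s := by
  rw [hv.unique ((hT.smul hf).add (hN.smul hh)) hJ hs e]
  module

/-- Antisymmetry in the first two arguments leaves only multiples of `R(N,T)T`. The two vectors in
the plane stand for `∇_T³T` and `∇_T²T`; the primes are not derivatives. -/
theorem frRiemann_osculating (a b f h f' h' : ℝ) (T N : Vec) (k : ℝ) :
    frRiemann a b (f • T + h • N) T T - frRiemann a b (f' • T + h' • N) (k • N) T
      = (h + f' * k) • frRiemann a b N T T := by
  ext i
  simp [frRiemann, dotProduct, Fin.sum_univ_three]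
  ring

theorem frRiemann_dot (a b : ℝ) {T N : Vec} (hT : T ⬝ᵥ T = 1) (hTN : T ⬝ᵥ N = 0) (v : Vec) :
    frRiemann a b N T T ⬝ᵥ v = (4 * a - 3 * b ^ 2 / 4) * (N ⬝ᵥ v)
      + (b ^ 2 - 4 * a) * (T 2 ^ 2 * (N ⬝ᵥ v) - N 2 * T 2 * (T ⬝ᵥ v) + N 2 * v 2) := by
  have hNT : N ⬝ᵥ T = 0 := by rw [dotProduct_comm]; exact hTN
  simp only [frRiemann, hT, hNT, add_dotProduct, sub_dotProduct, smul_dotProduct,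
    dotProduct_comm E₃ v, dot_E₃, smul_eq_mul]
  ring

theorem sum_sq_third_component {T N : Vec} (hT : T ⬝ᵥ T = 1) (hN : N ⬝ᵥ N = 1)
    (hTN : T ⬝ᵥ N = 0) : T 2 ^ 2 + N 2 ^ 2 + (T ⨯₃ N) 2 ^ 2 = 1 := by
  have h := congrArg (fun v => v ⬝ᵥ E₃) (orthonormal_expansion hT hN hTN E₃)
  simp only [add_dotProduct, smul_dotProduct, dotProduct_comm E₃, dot_E₃, smul_eq_mul] at h
  simp [E₃] at h
  simp [cross_apply] at h ⊢
  linear_combination -h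

/-- The tangential, normal and binormal components of the triharmonic equation. -/
theorem triharmonic_components {T N : Vec} {k k₁ k₂ k₃ k₄ : ℝ} (hT : T ⬝ᵥ T = 1)
    (hN : N ⬝ᵥ N = 1) (hTN : T ⬝ᵥ N = 0)
    (h : (-5 * k * k₃ - 10 * k₁ * k₂ + 10 * k ^ 3 * k₁) • T
      + (k₄ - 15 * k * k₁ ^ 2 - 10 * k ^ 2 * k₂ + k ^ 5) • N
      + (k₂ - 2 * k ^ 3) • frRiemann a b N T T = 0) :
    k * k₃ + 2 * k₁ * k₂ - 2 * k ^ 3 * k₁ = 0 ∧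
    k₄ - 15 * k * k₁ ^ 2 - 10 * k ^ 2 * k₂ + k ^ 5
      + (k₂ - 2 * k ^ 3) * (b ^ 2 / 4 + (4 * a - b ^ 2) * (T ⨯₃ N) 2 ^ 2) = 0 ∧
    (k₂ - 2 * k ^ 3) * ((b ^ 2 - 4 * a) * (N 2 * (T ⨯₃ N) 2)) = 0 := by
  have hNT : N ⬝ᵥ T = 0 := by rw [dotProduct_comm]; exact hTN
  have hBT : T ⬝ᵥ (T ⨯₃ N) = 0 := dot_self_cross T N
  have hBN : N ⬝ᵥ (T ⨯₃ N) = 0 := dot_cross_self T N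
  have hsum := sum_sq_third_component hT hN hTN
  have key : ∀ v : Vec, _ := fun v => congrArg (fun w => w ⬝ᵥ v) h
  simp only [add_dotProduct, smul_dotProduct, frRiemann_dot a b hT hTN, zero_dotProduct,
    smul_eq_mul] at key
  refine ⟨?_, ?_, ?_⟩
  · have := key T
    rw [hT, hNT] at this
    linear_combination -this / 5
  · have := key N
    rw [hN, hTN] at this
    -- Replacing `T₃² + N₃²` by `1 - B₃²` makes the sectional curvature depend on `B₃` alone.
    linear_combination this - (k₂ - 2 * k ^ 3) * (b ^ 2 - 4 * a) * hsum
  · have := key (T ⨯₃ N)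
    rw [hBT, hBN] at this
    linear_combination this

/-- The consequences of the triharmonic equation along a curve without torsion and without
inflection points, in the orthonormal frame. The field `t m` is `∇_T^m T`. -/
theorem planar_triharmonic (hab : 4 * a ≠ b ^ 2) (hJ : IsOpen J) (hc : IsPreconnected J)
    {t : ℕ → ℝ → Vec} (ht : ∀ m, ∀ s ∈ J, HasCov Ω (t m) (t (m + 1)) s)
    (hE : ∀ s ∈ J, HasCov Ω (fun _ => E₃) (fun s => (b / 2) • (t 0 s ⨯₃ E₃)) s)
    (hk : ContDiffOn ℝ ∞ k J) (hk0 : ∀ s ∈ J, k s ≠ 0)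
    (hTT : ∀ s ∈ J, t 0 s ⬝ᵥ t 0 s = 1) (hNN : ∀ s ∈ J, N s ⬝ᵥ N s = 1)
    (hkN : ∀ s ∈ J, t 1 s = k s • N s) (hN : ∀ s ∈ J, HasCov Ω N N' s)
    (htor : ∀ s ∈ J, N' s ⬝ᵥ (t 0 s ⨯₃ N s) = 0)
    (htri : ∀ s ∈ J, t 5 s + frRiemann a b (t 3 s) (t 0 s) (t 0 s)
      - frRiemann a b (t 2 s) (t 1 s) (t 0 s) = 0) :
    (∀ s ∈ J, ∀ s' ∈ J, k s = k s') ∧ ∀ s ∈ J,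
      k s ^ 2 = 2 * (b ^ 2 / 4 + (4 * a - b ^ 2) * (t 0 s ⨯₃ N s) 2 ^ 2) ∧
      HasDerivAt (fun s => (t 0 s ⨯₃ N s) 2) (b / 2 * N s 2) s ∧
      N s 2 * (t 0 s ⨯₃ N s) 2 = 0 ∧
      HasDerivAt (fun s => N s 2) (-(k s * t 0 s 2) - b / 2 * (t 0 s ⨯₃ N s) 2) s ∧
      t 0 s 2 ^ 2 + N s 2 ^ 2 + (t 0 s ⨯₃ N s) 2 ^ 2 = 1 := by
  have hT : ∀ s ∈ J, HasCov Ω (t 0) (fun s => k s • N s) s := fun s hs => (ht 0 s hs).congr (hkN s hs)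
  have hTN := dot_tangent_normal hJ hTT hk0 hT
  have hN' := hasCov_normal hJ hTT hNN hk0 hT hN htor
  have smooth : ∀ f : ℝ → ℝ, ContDiffOn ℝ ∞ f J → ∀ s ∈ J, HasDerivAt f (deriv f s) s :=
    fun f hf s hs => ((hf.contDiffAt (hJ.mem_nhds hs)).differentiableAt (by simp)).hasDerivAt
  obtain ⟨k₁, hs₁, h₀⟩ : ∃ k₁, ContDiffOn ℝ ∞ k₁ J ∧ ∀ s ∈ J, HasDerivAt k (k₁ s) s :=
    ⟨_, contDiffOn_deriv hJ hk, smooth k hk⟩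
  obtain ⟨k₂, hs₂, h₁⟩ : ∃ k₂, ContDiffOn ℝ ∞ k₂ J ∧ ∀ s ∈ J, HasDerivAt k₁ (k₂ s) s :=
    ⟨_, contDiffOn_deriv hJ hs₁, smooth k₁ hs₁⟩
  obtain ⟨k₃, hs₃, h₂⟩ : ∃ k₃, ContDiffOn ℝ ∞ k₃ J ∧ ∀ s ∈ J, HasDerivAt k₂ (k₃ s) s :=
    ⟨_, contDiffOn_deriv hJ hs₂, smooth k₂ hs₂⟩
  obtain ⟨k₄, h₃⟩ : ∃ k₄ : ℝ → ℝ, ∀ s ∈ J, HasDerivAt k₃ (k₄ s) s := ⟨_, smooth k₃ hs₃⟩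
  -- The zero coefficient gives the form required by `cov_osculating`, which then produces each
  -- further derivative from the previous one.
  have e₁ : ∀ s ∈ J, t 1 s = (0 : ℝ) • t 0 s + k s • N s := fun s hs => by simp [hkN s hs]
  have e₂ : ∀ s ∈ J, t 2 s = (-k s ^ 2) • t 0 s + k₁ s • N s := fun s hs => by
    rw [cov_osculating (f := fun _ => 0) (f' := fun _ => 0) hJ hs (hT s hs) (hN' s hs) (ht 1 s hs)
      e₁ (hasDerivAt_const s 0) (h₀ s hs)]
    module
  have e₃ : ∀ s ∈ J, t 3 s = (-(3 * k s * k₁ s)) • t 0 s + (k₂ s - k s ^ 3) • N s := fun s hs => by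
    rw [cov_osculating (f' := fun s => -(2 * k s * k₁ s)) hJ hs (hT s hs) (hN' s hs) (ht 2 s hs)
      e₂ (((h₀ s hs).pow 2).neg.congr_deriv (by simp)) (h₁ s hs)]
    module
  have e₄ : ∀ s ∈ J, t 4 s = (k s ^ 4 - 4 * k s * k₂ s - 3 * k₁ s ^ 2) • t 0 s
      + (k₃ s - 6 * k s ^ 2 * k₁ s) • N s := fun s hs => by
    rw [cov_osculating (f' := fun s => -(3 * k₁ s ^ 2 + 3 * k s * k₂ s))
      (h' := fun s => k₃ s - 3 * k s ^ 2 * k₁ s) hJ hs (hT s hs) (hN' s hs) (ht 3 s hs) e₃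
      ((((h₀ s hs).const_mul 3).mul (h₁ s hs)).neg.congr_deriv (by ring))
      (((h₂ s hs).sub ((h₀ s hs).pow 3)).congr_deriv (by simp))]
    module
  have e₅ : ∀ s ∈ J, t 5 s
      = (-5 * k s * k₃ s - 10 * k₁ s * k₂ s + 10 * k s ^ 3 * k₁ s) • t 0 s
      + (k₄ s - 15 * k s * k₁ s ^ 2 - 10 * k s ^ 2 * k₂ s + k s ^ 5) • N s := fun s hs => by
    rw [cov_osculating (f' := fun s => 4 * k s ^ 3 * k₁ s - 4 * k s * k₃ s - 10 * k₁ s * k₂ s)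
      (h' := fun s => k₄ s - 12 * k s * k₁ s ^ 2 - 6 * k s ^ 2 * k₂ s) hJ hs (hT s hs) (hN' s hs)
      (ht 4 s hs) e₄
      (((((h₀ s hs).pow 4).sub (((h₀ s hs).const_mul 4).mul (h₂ s hs))).sub
        (((h₁ s hs).pow 2).const_mul 3)).congr_deriv (by simp; ring))
      (((h₃ s hs).sub ((((h₀ s hs).pow 2).const_mul 6).mul (h₁ s hs))).congr_deriv (by simp; ring))]
    module
  have comp : ∀ s ∈ J, _ := fun s hs =>
    triharmonic_components (a := a) (b := b) (k := k s) (k₁ := k₁ s) (k₂ := k₂ s) (k₃ := k₃ s)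
      (k₄ := k₄ s) (hTT s hs) (hNN s hs) (hTN s hs) (by
        have h := htri s hs
        rw [add_sub_assoc, hkN s hs, e₂ s hs, e₃ s hs, e₅ s hs, frRiemann_osculating] at h
        rw [← h]
        module)
  have hNd : ∀ s ∈ J, HasDerivAt (fun s => N s 2)
      (-(k s * t 0 s 2) - b / 2 * (t 0 s ⨯₃ N s) 2) s := fun s hs => by
    have h := (hN' s hs).dot (hE s hs)
    simp only [dot_E₃] at h
    refine h.congr_deriv ?_
    simp [dotProduct, Fin.sum_univ_three, cross_apply, E₃]
    ring
  have hBd : ∀ s ∈ J, HasDerivAt (fun s => (t 0 s ⨯₃ N s) 2) (b / 2 * N s 2) s := fun s hs => by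
    have h := (hasCov_binormal (hT s hs) (hN' s hs)).dot (hE s hs)
    simp only [dot_E₃] at h
    refine h.congr_deriv ?_
    have h1 := hTT s hs
    have h2 := hTN s hs
    simp [dotProduct, Fin.sum_univ_three, cross_apply, E₃] at h1 h2 ⊢
    linear_combination b / 2 * N s 2 * h1 - b / 2 * t 0 s 2 * h2
  have hNB : ∀ s ∈ J, N s 2 * (t 0 s ⨯₃ N s) 2 = 0 := by
    refine eq_zero_of_binormal_equation hJ h₀ h₁ h₂ hk0 (fun s hs => (comp s hs).1) ?_
      fun s hs => ?_
    · exact fun s hs => ((hNd s hs).mul (hBd s hs)).continuousAt.continuousWithinAt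
    · have h := (comp s hs).2.2
      have hβ : b ^ 2 - 4 * a ≠ 0 := fun h => hab (by linarith)
      exact (mul_eq_zero.1 h).elim (fun h => by rw [h, zero_mul]) fun h => by
        rw [(mul_eq_zero.1 h).resolve_left hβ, mul_zero]
  have hBc : ∀ s ∈ J, ∀ s' ∈ J, (t 0 s ⨯₃ N s) 2 ^ 2 = (t 0 s' ⨯₃ N s') 2 ^ 2 :=
    fun s hs s' hs' => constant_of_hasDerivAt_zero hJ hc (fun x hx => (hBd x hx).pow 2)
      (fun x hx => by simp; exact (mul_eq_zero.1 (hNB x hx)).symm.imp id Or.inr) hs hs'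
  have hkc : ∀ s ∈ J, ∀ s' ∈ J, k s = k s' := fun s hs s' hs' =>
    curvature_constant hJ hc h₀ h₁ h₂ h₃ (fun x hx => (comp x hx).1)
      (b ^ 2 / 4 + (4 * a - b ^ 2) * (t 0 s ⨯₃ N s) 2 ^ 2)
      (fun x hx => by rw [hBc s hs x hx]; exact (comp x hx).2.1) hs hs'
  exact ⟨hkc, fun s hs => ⟨sq_of_curvature_constant hJ h₀ h₁ h₂ h₃ hkc hs (hk0 s hs)
    (comp s hs).2.1, hBd s hs, hNB s hs, hNd s hs,
    sum_sq_third_component (hTT s hs) (hNN s hs) (hTN s hs)⟩⟩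

end Frenet

/-! ### From inflection-free intervals to the whole curve -/

section Main

variable {a b : ℝ} {I J : Set ℝ} {γ : ℝ → Vec}

theorem IsTriharmonic.mono (h : IsTriharmonic (metric a b) (domain a) I γ) (hJI : J ⊆ I) :
    IsTriharmonic (metric a b) (domain a) J γ :=
  ⟨⟨h.1.smooth.mono hJI, h.1.mapsTo.mono_left hJI, fun s hs => h.1.unit_speed s (hJI hs)⟩,
    fun s hs => h.2 s (hJI hs)⟩

/-- `⟨T, E₃⟩`. -/
noncomputable def tangent₃ (a b : ℝ) (γ : ℝ → Vec) (s : ℝ) : ℝ := fr a b (γ s) (deriv γ s) 2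

/-- `⟨N, E₃⟩`. -/
noncomputable def normal₃ (a b : ℝ) (γ : ℝ → Vec) (s : ℝ) : ℝ :=
  fr a b (γ s) (normal (metric a b) γ s) 2

/-- `⟨B, E₃⟩`. -/
noncomputable def binormal₃ (a b : ℝ) (γ : ℝ → Vec) (s : ℝ) : ℝ :=
  ip (metric a b) (γ s) (binormal (metric a b) γ s) E₃

theorem binormal₃_eq {s : ℝ} (hs : γ s ∈ domain a) : binormal₃ a b γ s =
    (fr a b (γ s) (deriv γ s) ⨯₃ fr a b (γ s) (normal (metric a b) γ s)) 2 := by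
  rw [binormal₃, ip_metric, fr_E₃, dot_E₃, binormal, fr_cross hs]

theorem curvature_eq (a b : ℝ) (γ : ℝ → Vec) (s : ℝ) : curvature (metric a b) γ s =
    Real.sqrt (fr a b (γ s) (covT (metric a b) γ 1 s) ⬝ᵥ fr a b (γ s) (covT (metric a b) γ 1 s)) := by
  rw [curvature, ip_metric]

theorem dotProduct_self_nonneg_vec (v : Vec) : 0 ≤ v ⬝ᵥ v := by
  simp only [dotProduct, Fin.sum_univ_three]
  nlinarith [mul_self_nonneg (v 0), mul_self_nonneg (v 1), mul_self_nonneg (v 2)]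

theorem curvature_sq (a b : ℝ) (γ : ℝ → Vec) (s : ℝ) : curvature (metric a b) γ s ^ 2 =
    fr a b (γ s) (covT (metric a b) γ 1 s) ⬝ᵥ fr a b (γ s) (covT (metric a b) γ 1 s) := by
  rw [curvature_eq, Real.sq_sqrt (dotProduct_self_nonneg_vec _)]

theorem contDiffOn_curvature_sq (b : ℝ) (hJ : IsOpen J) (hγ : ContDiffOn ℝ ∞ γ J)
    (hmaps : Set.MapsTo γ J (domain a)) :
    ContDiffOn ℝ ∞ (fun s => fr a b (γ s) (covT (metric a b) γ 1 s) ⬝ᵥ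
      fr a b (γ s) (covT (metric a b) γ 1 s)) J := by
  have h := contDiffOn_pi.1 (contDiffOn_fr (b := b) hγ hmaps (contDiffOn_covT (b := b) hJ hγ hmaps 1))
  simp only [dotProduct]
  exact ContDiffOn.sum fun i _ => (h i).mul (h i)

/-- Continuity survives at inflection points, where smoothness of the square root may fail; it makes
the set `κ ≠ 0` open. -/
theorem continuousOn_curvature (b : ℝ) (hJ : IsOpen J) (hγ : ContDiffOn ℝ ∞ γ J)
    (hmaps : Set.MapsTo γ J (domain a)) : ContinuousOn (curvature (metric a b) γ) J :=
  (Real.continuous_sqrt.comp_continuousOn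
    (contDiffOn_curvature_sq b hJ hγ hmaps).continuousOn).congr fun s _ => curvature_eq a b γ s

/-- A triharmonic curve without torsion and without inflection points has constant curvature. -/
theorem IsTriharmonic.of_curvature_ne_zero (hab : 4 * a ≠ b ^ 2) (hJ : IsOpen J)
    (hc : IsPreconnected J) (h : IsTriharmonic (metric a b) (domain a) J γ)
    (htor : HasVanishingTorsion (metric a b) J γ)
    (hk0 : ∀ s ∈ J, curvature (metric a b) γ s ≠ 0) :
    (∀ s ∈ J, ∀ s' ∈ J, curvature (metric a b) γ s = curvature (metric a b) γ s') ∧ ∀ s ∈ J,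
      curvature (metric a b) γ s ^ 2
        = 2 * (b ^ 2 / 4 + (4 * a - b ^ 2) * binormal₃ a b γ s ^ 2) ∧
      HasDerivAt (binormal₃ a b γ) (b / 2 * normal₃ a b γ s) s ∧
      normal₃ a b γ s * binormal₃ a b γ s = 0 ∧
      HasDerivAt (normal₃ a b γ)
        (-(curvature (metric a b) γ s * tangent₃ a b γ s) - b / 2 * binormal₃ a b γ s) s ∧
      tangent₃ a b γ s ^ 2 + normal₃ a b γ s ^ 2 + binormal₃ a b γ s ^ 2 = 1 := by
  obtain ⟨⟨hγ, hmaps, hunit⟩, htri⟩ := h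
  have hk : ContDiffOn ℝ ∞ (curvature (metric a b) γ) J := by
    refine ((contDiffOn_curvature_sq b hJ hγ hmaps).sqrt fun s hs => ?_).congr
      fun s _ => curvature_eq a b γ s
    rw [← curvature_sq]
    exact pow_ne_zero 2 (hk0 s hs)
  have hn : ContDiffOn ℝ ∞ (normal (metric a b) γ) J :=
    (hk.inv hk0).smul (contDiffOn_covT hJ hγ hmaps 1)
  have hkN : ∀ s ∈ J, fr a b (γ s) (covT (metric a b) γ 1 s)
      = curvature (metric a b) γ s • fr a b (γ s) (normal (metric a b) γ s) := fun s hs => by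
    rw [normal, fr_smul, smul_inv_smul₀ (hk0 s hs)]
  have main := planar_triharmonic hab hJ hc (Ω := angular a b γ)
    (t := fun m s => fr a b (γ s) (covT (metric a b) γ m s))
    (N := fun s => fr a b (γ s) (normal (metric a b) γ s))
    (N' := fun s => fr a b (γ s) (covDeriv (metric a b) γ (normal (metric a b) γ) s))
    (fun m s hs => hasCov_covT b hJ hγ hmaps m hs) (fun s _ => hasCov_E₃ a b γ s) hk hk0
    (fun s hs => by rw [← ip_metric]; exact hunit s hs)
    (fun s hs => by
      have h := curvature_sq a b γ s
      rw [hkN s hs, smul_dotProduct, dotProduct_smul, smul_eq_mul, smul_eq_mul, ← mul_assoc,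
        ← pow_two] at h
      exact (mul_eq_left₀ (pow_ne_zero 2 (hk0 s hs))).1 h.symm)
    hkN
    (fun s hs => hasCov_fr (hmaps hs)
      ((hγ.contDiffAt (hJ.mem_nhds hs)).differentiableAt (by simp))
      ((hn.contDiffAt (hJ.mem_nhds hs)).differentiableAt (by simp)))
    (fun s hs => by
      have h := htor s hs (hk0 s hs)
      rw [torsion, ip_metric, binormal, fr_cross (hmaps hs)] at h
      exact h)
    (fun s hs => by
      have h := congrArg (fr a b (γ s)) (htri s hs)
      rw [tension₃, fr_sub, fr_add, fr_riemann (hmaps hs), fr_riemann (hmaps hs), fr_zero] at h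
      exact h)
  refine ⟨main.1, fun s hs => ?_⟩
  obtain ⟨m1, m2, m3, m4, m5⟩ := main.2 s hs
  rw [binormal₃_eq (hmaps hs)]
  refine ⟨m1, m2.congr_of_eventuallyEq ?_, m3, m4, m5⟩
  exact Filter.eventually_of_mem (hJ.mem_nhds hs) fun x hx => binormal₃_eq (hmaps hx)

/-- A triharmonic curve without torsion is a geodesic or has no inflection points. -/
theorem IsTriharmonic.geodesic_or_ne_zero (hab : 4 * a ≠ b ^ 2) (hI : IsOpen I)
    (hc : IsPreconnected I) (h : IsTriharmonic (metric a b) (domain a) I γ)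
    (htor : HasVanishingTorsion (metric a b) I γ) :
    IsGeodesic (metric a b) I γ ∨ ∀ s ∈ I, curvature (metric a b) γ s ≠ 0 := by
  have hcont := continuousOn_curvature b hI h.1.smooth h.1.mapsTo
  by_cases hall : ∀ s ∈ I, curvature (metric a b) γ s = 0
  · refine Or.inl fun s hs => eq_zero_of_fr_eq_zero (h.1.mapsTo hs) ?_ (b := b)
    have e := curvature_sq a b γ s
    rw [hall s hs] at e
    exact dotProduct_self_eq_zero.1 (by rw [← e]; norm_num)
  push Not at hall
  obtain ⟨s₀, hs₀, hne⟩ := hall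
  right
  have hlocal : ∀ s ∈ I, curvature (metric a b) γ s ≠ 0 →
      ∀ᶠ x in nhds s, curvature (metric a b) γ x = curvature (metric a b) γ s := by
    intro s hs hks
    have hU : IsOpen (I ∩ curvature (metric a b) γ ⁻¹' {0}ᶜ) :=
      hcont.isOpen_inter_preimage hI isOpen_compl_singleton
    obtain ⟨ε, hε, hball⟩ := Metric.isOpen_iff.1 hU s ⟨hs, hks⟩
    have hsub : Metric.ball s ε ⊆ I := fun x hx => (hball hx).1
    have := (IsTriharmonic.of_curvature_ne_zero hab Metric.isOpen_ball
      (convex_ball s ε).isPreconnected (h.mono hsub) (fun x hx => htor x (hsub hx))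
      fun x hx => (hball hx).2).1
    exact Filter.eventually_of_mem (Metric.ball_mem_nhds s hε)
      fun x hx => this x hx s (Metric.mem_ball_self hε)
  intro s hs
  -- The interior of this level set is relatively closed in `I`: continuity carries the nonzero
  -- value to limit points, and `hlocal` makes the curvature constant near them.
  have hconst : I ⊆ {x | curvature (metric a b) γ x = curvature (metric a b) γ s₀} := by
    refine hc.subset_of_closure_inter_subset (u := interior
      {x | curvature (metric a b) γ x = curvature (metric a b) γ s₀}) isOpen_interior ⟨s₀, hs₀, ?_⟩
      ?_ |>.trans interior_subset
    · exact mem_interior_iff_mem_nhds.2 (hlocal s₀ hs₀ hne)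
    · rintro x ⟨hx, hxI⟩
      have e : curvature (metric a b) γ x = curvature (metric a b) γ s₀ := by
        by_contra hxne
        have hV : IsOpen (I ∩ curvature (metric a b) γ ⁻¹' {curvature (metric a b) γ s₀}ᶜ) :=
          hcont.isOpen_inter_preimage hI isOpen_compl_singleton
        obtain ⟨y, hy, hy'⟩ := mem_closure_iff.1 hx _ hV ⟨hxI, hxne⟩
        have hy'' : y ∈ {x | curvature (metric a b) γ x = curvature (metric a b) γ s₀} :=
          interior_subset hy'
        exact hy.2 hy''
      refine mem_interior_iff_mem_nhds.2 ?_
      have := hlocal x hxI (by rw [e]; exact hne)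
      rw [e] at this
      exact this
  rw [show curvature (metric a b) γ s = curvature (metric a b) γ s₀ from hconst hs]
  exact hne

/-- The square of `B₃` has derivative `b N₃ B₃ = 0`. So either `B₃` vanishes identically, or it
vanishes nowhere and then `N₃ = 0` kills `B₃'`. -/
theorem binormal₃_constant (hI : IsOpen I) (hc : IsPreconnected I)
    (hd : ∀ s ∈ I, HasDerivAt (binormal₃ a b γ) (b / 2 * normal₃ a b γ s) s)
    (h0 : ∀ s ∈ I, normal₃ a b γ s * binormal₃ a b γ s = 0) :
    ∀ s ∈ I, ∀ s' ∈ I, binormal₃ a b γ s = binormal₃ a b γ s' := by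
  have hsq : ∀ s ∈ I, ∀ s' ∈ I, binormal₃ a b γ s ^ 2 = binormal₃ a b γ s' ^ 2 :=
    fun s hs s' hs' => constant_of_hasDerivAt_zero hI hc (fun x hx => (hd x hx).pow 2)
      (fun x hx => by simp; exact (mul_eq_zero.1 (h0 x hx)).symm.imp id Or.inr) hs hs'
  intro s hs s' hs'
  by_cases hz : binormal₃ a b γ s = 0
  · have h := hsq s hs s' hs'
    rw [hz] at h ⊢
    exact (pow_eq_zero_iff two_ne_zero |>.1 (h.symm.trans (by norm_num))).symm
  · refine constant_of_hasDerivAt_zero hI hc hd (fun x hx => ?_) hs hs'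
    have hx0 : binormal₃ a b γ x ≠ 0 := fun h => hz (by
      have e := hsq s hs x hx
      rw [h] at e
      exact pow_eq_zero_iff two_ne_zero |>.1 (e.trans (by norm_num)))
    rw [(mul_eq_zero.1 (h0 x hx)).resolve_right hx0, mul_zero]

theorem IsTriharmonic.geodesic_or_helix (hab : 4 * a ≠ b ^ 2) (hI : IsOpen I)
    (hc : I.OrdConnected) (h : IsTriharmonic (metric a b) (domain a) I γ)
    (htor : HasVanishingTorsion (metric a b) I γ) :
    IsGeodesic (metric a b) I γ ∨ ∃ κ₀ B₃ : ℝ,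
      IsFrenetHelix (metric a b) I γ κ₀ 0 ∧
      (∀ s ∈ I, ip (metric a b) (γ s) (binormal (metric a b) γ s) E₃ = B₃) ∧
      κ₀ ^ 2 = 2 * (b ^ 2 / 4 + (4 * a - b ^ 2) * B₃ ^ 2) ∧
      (4 * a < b ^ 2 → B₃ ^ 2 < b ^ 2 / (4 * (b ^ 2 - 4 * a))) ∧ (b ^ 2 < 4 * a → B₃ ≠ 0) := by
  -- An empty interval counts as a geodesic; otherwise `s₀` supplies the values `κ₀` and `B₃`.
  rcases I.eq_empty_or_nonempty with rfl | ⟨s₀, hs₀⟩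
  · exact Or.inl fun s hs => hs.elim
  have hpre := hc.isPreconnected
  refine (h.geodesic_or_ne_zero hab hI hpre htor).imp id fun hk0 => ?_
  obtain ⟨hk, hm⟩ := h.of_curvature_ne_zero hab hI hpre htor hk0
  have hB := binormal₃_constant hI hpre (fun s hs => (hm s hs).2.1) fun s hs => (hm s hs).2.2.1
  have hpos : 0 < curvature (metric a b) γ s₀ :=
    lt_of_le_of_ne (Real.sqrt_nonneg _) (hk0 s₀ hs₀).symm
  have hsq := (hm s₀ hs₀).1
  have hsqpos := pow_pos hpos 2
  refine ⟨curvature (metric a b) γ s₀, binormal₃ a b γ s₀,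
    ⟨hpos, fun s hs => ⟨hk s hs s₀ hs₀, htor s hs (hk0 s hs)⟩⟩, fun s hs => hB s hs s₀ hs₀, hsq,
    fun hlt => ?_, fun hlt hB0 => ?_⟩
  · rw [lt_div_iff₀ (by linarith)]
    nlinarith
  -- If `B₃ = 0`, then `κ₀² = b²/2` gives `b ≠ 0`, so `B₃' = 0` gives `N₃ = 0`, and `N₃' = 0` gives
  -- `T₃ = 0`. The unit vector `E₃` would then have no components.
  · have hb : b ≠ 0 := by
      rintro rfl
      rw [hB0] at hsq
      norm_num at hsq
      exact hk0 s₀ hs₀ hsq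
    have hN : ∀ s ∈ I, normal₃ a b γ s = 0 := fun s hs => by
      have e := deriv_eq_of_eqOn hI hs (hm s hs).2.1 (hasDerivAt_const s (binormal₃ a b γ s₀))
        fun x hx => hB x hx s₀ hs₀
      simpa [hb] using e
    have hN' := deriv_eq_of_eqOn hI hs₀ (hm s₀ hs₀).2.2.2.1 (hasDerivAt_const s₀ 0) hN
    have hT : tangent₃ a b γ s₀ = 0 := by
      rw [hB0] at hN'
      simpa [hk0 s₀ hs₀] using hN'
    have hsum := (hm s₀ hs₀).2.2.2.2
    rw [hT, hN s₀ hs₀, hB0] at hsum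
    norm_num at hsum

theorem IsTriharmonic.exists_curvature_eq (hab : 4 * a ≠ b ^ 2) (hI : IsOpen I)
    (hc : I.OrdConnected) (h : IsTriharmonic (metric a b) (domain a) I γ)
    (htor : HasVanishingTorsion (metric a b) I γ) :
    ∃ c : ℝ, ∀ s ∈ I, curvature (metric a b) γ s = c := by
  rcases h.geodesic_or_helix hab hI hc htor with hg | ⟨κ₀, _, hh, _⟩
  · exact ⟨0, fun s hs => by simp [curvature, hg s hs, ip]⟩
  · exact ⟨κ₀, fun s hs => (hh.2 s hs).1⟩

theorem hypProdMetric_eq (ρ : ℝ) : hypProdMetric ρ = metric (ρ / 4) 0 := by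
  funext p
  ext i j
  fin_cases i <;> fin_cases j <;> simp [hypProdMetric, metric, form, lam]

theorem hypProdDomain_eq {ρ : ℝ} (hρ : ρ < 0) : hypProdDomain ρ = domain (ρ / 4) := by
  ext p
  have e : lam (ρ / 4) p = -ρ / 4 * (-(4 / ρ) - (p 0 ^ 2 + p 1 ^ 2)) := by
    have hρ' := hρ.ne
    rw [lam]; field_simp; ring
  rw [domain, hypProdDomain, Set.mem_ofPred_eq, Set.mem_ofPred_eq, e,
    mul_pos_iff_of_pos_left (by linarith), sub_pos]

end Main

end BCV

theorem mainTheorem7 :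
    (∀ (a b : ℝ), 4 * a ≠ b ^ 2 →
      ∀ (I : Set ℝ), IsOpen I → I.OrdConnected →
      ∀ (γ : ℝ → BCV.Vec),
        BCV.IsTriharmonic (BCV.metric a b) (BCV.domain a) I γ →
        BCV.HasVanishingTorsion (BCV.metric a b) I γ →
        -- the curvature is constant
        (∃ c : ℝ, ∀ s ∈ I, BCV.curvature (BCV.metric a b) γ s = c) ∧
        -- geodesic, or Frenet helix with the given curvature
        (BCV.IsGeodesic (BCV.metric a b) I γ ∨
          ∃ κ₀ B₃ : ℝ,
            BCV.IsFrenetHelix (BCV.metric a b) I γ κ₀ 0 ∧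
            (∀ s ∈ I, BCV.ip (BCV.metric a b) (γ s)
              (BCV.binormal (BCV.metric a b) γ s) BCV.E₃ = B₃) ∧
            κ₀ ^ 2 = 2 * (b ^ 2 / 4 + (4 * a - b ^ 2) * B₃ ^ 2) ∧
            (4 * a < b ^ 2 → B₃ ^ 2 < b ^ 2 / (4 * (b ^ 2 - 4 * a))) ∧
            (b ^ 2 < 4 * a → B₃ ≠ 0))) ∧
    -- no proper triharmonic curves with vanishing torsion in the product space
    (∀ ρ : ℝ, ρ < 0 →
      ¬ ∃ (I : Set ℝ) (γ : ℝ → BCV.Vec), IsOpen I ∧ I.OrdConnected ∧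
        BCV.IsTriharmonic (BCV.hypProdMetric ρ) (BCV.hypProdDomain ρ) I γ ∧
        BCV.HasVanishingTorsion (BCV.hypProdMetric ρ) I γ ∧
        ¬ BCV.IsGeodesic (BCV.hypProdMetric ρ) I γ) := by

  refine ⟨fun a b hab I hI hc γ h htor => ⟨h.exists_curvature_eq hab hI hc htor,
    h.geodesic_or_helix hab hI hc htor⟩, fun ρ hρ => ?_⟩
  rintro ⟨I, γ, hI, hc, h, htor, hng⟩
  rw [BCV.hypProdMetric_eq, BCV.hypProdDomain_eq hρ] at h
  rw [BCV.hypProdMetric_eq] at htor hng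
  have hlt : 4 * (ρ / 4) < (0 : ℝ) ^ 2 := by linarith
  obtain ⟨κ₀, B₃, -, -, -, hB, -⟩ := (h.geodesic_or_helix hlt.ne hI hc htor).resolve_left hng
  have hB := hB hlt
  -- For `b = 0` the upper bound on `B₃²` is zero.
  norm_num at hB
  nlinarith [sq_nonneg B₃]
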